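/- Let $a<b$ be coprime positive integers and $[b-1]=\{1,\dots,b-1\}$. A set partition $\pi$ of $[n]$ is noncrossing if, for $i<j<k<\ell$ in $[n]$, $i\sim k$ and $j\sim\ell$ together imply $i\sim j\sim k\sim\ell$. The rotation operator $\mathrm{rot}$ acts on set partitions of $[n]$ through the permutation $i\mapsto i+1$ $(1\le i<n)$, $n\mapsto 1$. An $a,b$-Dyck path $D$ is a lattice path of unit north and east steps from $(0,0)$ to $(b,a)$ which stays weakly above the line $y=\frac ab x$. A valley of $D$ is a lattice point of $D$ immediately preceded by an east step and succeeded by a north step. From every valley $P$ fire a laser: the line segment of slope $\frac ab$ going northeast from $P$ until it first meets $D$ again (which happens in the interior of an east step). Label the east ends of the non-terminal east steps of $D$ from left to right by $1,\dots,b-1$, the labels lying slightly below their lattice points, and let $\pi(D)$ be the set partition of $[b-1]$ in which $i\sim j$ if and only if the labels $i$ and $j$ are not separated by a laser. (Equivalently, if the laser from a valley with $x$-coordinate $p$ ends in the interior of the east step with west $x$-coordinate $m$, it separates the labels $p+1,\dots,m$ from all others.) Put $\mathrm{NC}(a,b)=\{\pi(D): D \text{ an } a,b\text{-Dyck path}\}$.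 For a noncrossing partition $\pi$ of $[b-1]$, order its blocks by $B'\preceq B$ iff $[\min B',\max B']\subseteq[\min B,\max B]$. The ranks $\mathrm{rank}^{\pi}_{a,b}(B)\in\mathbb Z$ of the blocks $B$ of $\pi$ are determined recursively by $$\sum_{B'\preceq B}\mathrm{rank}^{\pi}_{a,b}(B')=\left\lceil(\max B-\min B+1)\frac ab\right\rceil\qquad\text{for all blocks } B\in\pi .$$ We say that $\pi$ has a valid $a,b$-ranking if $\mathrm{rank}^{\pi}_{a,b}(B)>0$ for every block $B\in\pi$ and $\sum_{B\in\pi}\mathrm{rank}^{\pi}_{a,b}(B)=a$. **Proposition.** Let $a<b$ be coprime positive integers and let $\pi$ be a noncrossing partition of $[b-1]$. Then $\pi\in\mathrm{NC}(a,b)$ if and only if every partition in the orbit of $\pi$ under rotation has a valid $a,b$-ranking. -/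

import Mathlib

namespace RationalCatalan

/-! ### Set partitions of `[n]`

Set partitions of `[n] = {1, …, n}` are `Finpartition (Finset.univ : Finset (Fin n))`, where
`i : Fin n` stands for the label `i.val + 1`. -/

/-- Set partitions of `[n]`. -/
abbrev SetPartition (n : ℕ) : Type := Finpartition (Finset.univ : Finset (Fin n))

/-- `i ∼ k` and `j ∼ l` with `i < j < k < l` imply `i ∼ j ∼ k ∼ l`. -/
def IsNoncrossing {n : ℕ} (π : SetPartition n) : Prop :=
  ∀ i j k l : Fin n, i < j → j < k → k < l →
    π.part i = π.part k → π.part j = π.part l →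
      π.part i = π.part j ∧ π.part j = π.part k ∧ π.part k = π.part l

/-- The action of a permutation of the ground set on its subsets. -/
def permFinset {n : ℕ} (e : Equiv.Perm (Fin n)) : Finset (Fin n) ≃o Finset (Fin n) where
  toEquiv := e.finsetCongr
  map_rel_iff' := by intro s t; simp

/-- The rotation operator: the permutation `i ↦ i + 1`, `n ↦ 1` applied to a set partition. -/
def rot {n : ℕ} (π : SetPartition n) : SetPartition n :=
  (π.map (permFinset (finRotate n))).copy (by simp [permFinset])

theorem rot_parts {n : ℕ} (π : SetPartition n) :
    (rot π).parts = π.parts.image (fun B => B.map (finRotate n).toEmbedding) := by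
  change π.parts.map _ = _
  rw [Finset.map_eq_image]
  rfl

/-- The orbit of `π` under rotation. (Rotation has finite order, so non-negative powers suffice.) -/
def rotOrbit {n : ℕ} (π : SetPartition n) : Set (SetPartition n) :=
  {ρ | ∃ k : ℕ, ρ = rot^[k] π}

/-! ### Rational Dyck paths and the visibility partition -/

/-- An `a,b`-Dyck path: a lattice path from `(0,0)` to `(b,a)` with unit north and east steps which
stays (weakly) above the line `y = (a/b) x`; `pt k` is the lattice point reached after `k` steps. -/
structure DyckPath (a b : ℕ) where
  pt : Fin (a + b + 1) → ℕ × ℕ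
  pt_zero : pt 0 = (0, 0)
  pt_last : pt (Fin.last (a + b)) = (b, a)
  step : ∀ k : Fin (a + b),
    pt k.succ = pt k.castSucc + (1, 0) ∨ pt k.succ = pt k.castSucc + (0, 1)
  above : ∀ k, a * (pt k).1 ≤ b * (pt k).2

namespace DyckPath

variable {a b : ℕ}

/-- Step number `k` is an east step. -/
def IsEast (D : DyckPath a b) (k : Fin (a + b)) : Prop := D.pt k.succ = D.pt k.castSucc + (1, 0)

/-- Step number `k` is a north step. -/
def IsNorth (D : DyckPath a b) (k : Fin (a + b)) : Prop := D.pt k.succ = D.pt k.castSucc + (0, 1)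

/-- `P` is a valley of `D`: immediately preceded by an east step, succeeded by a north step. -/
def IsValley (D : DyckPath a b) (P : ℕ × ℕ) : Prop :=
  ∃ k l : Fin (a + b), k.succ = l.castSucc ∧ D.pt l.castSucc = P ∧ D.IsEast k ∧ D.IsNorth l

/-- A lattice point as a point of the plane. -/
def toPlane (P : ℕ × ℕ) : ℝ × ℝ := ((P.1 : ℝ), (P.2 : ℝ))

/-- The path as a subset of the plane. -/
def support (D : DyckPath a b) : Set (ℝ × ℝ) :=
  {Q | ∃ k : Fin (a + b), Q ∈ segment ℝ (toPlane (D.pt k.castSucc)) (toPlane (D.pt k.succ))}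

/-- The parameters `t > 0` at which the ray of slope `a/b` fired northeast from `P`,
`t ↦ P + t (b, a)`, meets the path. -/
def hits (D : DyckPath a b) (P : ℕ × ℕ) : Set ℝ :=
  {t | 0 < t ∧ ((P.1 : ℝ) + t * b, (P.2 : ℝ) + t * a) ∈ D.support}

/-- The laser set of `D`: the pairs `(i, j)` such that there is a valley `P` with `x`-coordinate `i`
whose laser (the segment of slope `a/b` fired northeast from `P` until it meets `D` again) ends in
the interior of the east step of `D` with west `x`-coordinate `j`. -/
def lasers (D : DyckPath a b) : Set (ℕ × ℕ) :=
  {q | ∃ P : ℕ × ℕ, D.IsValley P ∧ P.1 = q.1 ∧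
    ∃ t : ℝ, IsLeast (D.hits P) t ∧
      ∃ k : Fin (a + b), D.IsEast k ∧ (D.pt k.castSucc).1 = q.2 ∧
        ((P.1 : ℝ) + t * b, (P.2 : ℝ) + t * a) ∈
          openSegment ℝ (toPlane (D.pt k.castSucc)) (toPlane (D.pt k.succ))}

/-- The label `i` lies in the pocket between `D` and the laser with end data `q`. Label `i` is placed
slightly below the east end of the `i`-th east step, a point with `x`-coordinate `i`; so the label
at the source of the laser is outside of the pocket, and the pocket holds `q.1 + 1, …, q.2`. -/
def InPocket (q : ℕ × ℕ) (i : ℕ) : Prop := q.1 < i ∧ i ≤ q.2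

/-- The visibility relation: labels that are not separated by laser fire. -/
def visibility (D : DyckPath a b) : Setoid (Fin (b - 1)) where
  r i j := ∀ q ∈ D.lasers, (InPocket q (i.val + 1) ↔ InPocket q (j.val + 1))
  iseqv :=
    { refl := fun _ _ _ => Iff.rfl
      symm := fun h q hq => (h q hq).symm
      trans := fun h h' q hq => (h q hq).trans (h' q hq) }

open Classical in
/-- The set partition `π(D)` of `[b-1]`. -/
noncomputable def partition (D : DyckPath a b) : SetPartition (b - 1) :=
  Finpartition.ofSetoid D.visibility

end DyckPath

/-- The set `NC(a,b)` of `a,b`-noncrossing partitions. -/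
def NC (a b : ℕ) : Set (SetPartition (b - 1)) := {π | ∃ D : DyckPath a b, D.partition = π}

/-! ### Ranks -/

/-- The smallest label of a nonempty block (junk value `0` on the empty set). -/
def minLabel {n : ℕ} (B : Finset (Fin n)) : ℕ := if h : B.Nonempty then (B.min' h).val + 1 else 0

/-- The largest label of a nonempty block (junk value `0` on the empty set). -/
def maxLabel {n : ℕ} (B : Finset (Fin n)) : ℕ := if h : B.Nonempty then (B.max' h).val + 1 else 0

/-- `B' ⪯ B`, that is, `[min B', max B'] ⊆ [min B, max B]`. -/
def BlockLE {n : ℕ} (B' B : Finset (Fin n)) : Prop :=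
  Set.Icc (minLabel B') (maxLabel B') ⊆ Set.Icc (minLabel B) (maxLabel B)

/-- The target `⌈(max B - min B + 1) a / b⌉` of the rank recursion. -/
def rankSum (a b : ℕ) {n : ℕ} (B : Finset (Fin n)) : ℤ :=
  ⌈((maxLabel B : ℚ) - (minLabel B : ℚ) + 1) * ((a : ℚ) / (b : ℚ))⌉

theorem minLabel_le_maxLabel {n : ℕ} (B : Finset (Fin n)) : minLabel B ≤ maxLabel B := by
  unfold minLabel maxLabel
  split_ifs with h
  · exact Nat.succ_le_succ (Fin.le_def.mp (B.min'_le_max' h))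
  · exact le_rfl

theorem BlockLE.le {n : ℕ} {B' B : Finset (Fin n)} (h : BlockLE B' B) :
    minLabel B ≤ minLabel B' ∧ maxLabel B' ≤ maxLabel B :=
  (Set.Icc_subset_Icc_iff (minLabel_le_maxLabel B')).mp h

/-- On the blocks of a set partition, `⪯` is antisymmetric, so a block strictly below another one
spans a strictly shorter interval. -/
theorem BlockLE.lt_of_ne {n : ℕ} {π : SetPartition n} {B' B : Finset (Fin n)}
    (hB' : B' ∈ π.parts) (hB : B ∈ π.parts) (h : BlockLE B' B) (hne : B' ≠ B) :
    maxLabel B' - minLabel B' < maxLabel B - minLabel B := by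
  have h1 := h.le
  have h2 := minLabel_le_maxLabel B'
  have h3 : minLabel B ≠ minLabel B' := by
    intro he
    apply hne
    have n' := π.nonempty_of_mem_parts hB'
    have n := π.nonempty_of_mem_parts hB
    simp only [minLabel, dif_pos n, dif_pos n', add_left_inj] at he
    have he' := Fin.ext he
    exact π.eq_of_mem_parts hB' hB (B'.min'_mem n') (he' ▸ B.min'_mem n)
  omega

open Classical in
/-- The `a,b`-rank of a block `B` of `π`, by recursion on the order `⪯`:
`rank B = ⌈(max B - min B + 1) a / b⌉ - ∑_{B' ≺ B} rank B'`. -/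
noncomputable def rank (a b : ℕ) {n : ℕ} (π : SetPartition n) (B : {B // B ∈ π.parts}) : ℤ :=
  rankSum a b B.1 -
    ∑ B' : {B' : {B' // B' ∈ π.parts} // BlockLE B'.1 B.1 ∧ B' ≠ B}, rank a b π B'.1
termination_by maxLabel B.1 - minLabel B.1
decreasing_by
  exact BlockLE.lt_of_ne B'.1.2 B.2 B'.2.1 (fun h => B'.2.2 (Subtype.ext h))

open Classical in
/-- The formula that determines ranks: `∑_{B' ⪯ B} rank B' = ⌈(max B - min B + 1) a / b⌉`. -/
theorem sum_rank (a b : ℕ) {n : ℕ} (π : SetPartition n) (B : {B // B ∈ π.parts}) :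
    ∑ B' with BlockLE B'.1 B.1, rank a b π B' = rankSum a b B.1 := by
  have h : ∑ B' : {B' : {B' // B' ∈ π.parts} // BlockLE B'.1 B.1 ∧ B' ≠ B}, rank a b π B'.1 =
      ∑ B' with BlockLE B'.1 B.1 ∧ B' ≠ B, rank a b π B' :=
    (Finset.sum_subtype _ (by simp) _).symm
  have hB : B ∈ Finset.univ.filter
      (fun B' : {B' // B' ∈ π.parts} => BlockLE B'.1 B.1) := by
    rw [Finset.mem_filter]
    exact ⟨Finset.mem_univ _, subset_rfl⟩
  rw [← Finset.sum_erase_add _ _ hB]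
  conv_lhs => rw [rank]
  rw [h]
  have he : (Finset.univ.filter
      (fun B' : {B' // B' ∈ π.parts} => BlockLE B'.1 B.1)).erase B =
      Finset.univ.filter (fun B' => BlockLE B'.1 B.1 ∧ B' ≠ B) := by
    ext x
    simp [and_comm]
  rw [he]
  ring

/-- `π` has a valid `a,b`-ranking: all ranks are positive and they sum to `a`. -/
def HasValidRanking (a b : ℕ) {n : ℕ} (π : SetPartition n) : Prop :=
  (∀ B : {B // B ∈ π.parts}, 0 < rank a b π B) ∧
    ∑ B : {B // B ∈ π.parts}, rank a b π B = (a : ℤ)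

end RationalCatalan

/-! Record a path by the heights of its east steps and by its slack `b * height x - a * x`. Slack is
constant along lines of slope `a/b`, so a laser fired at `p` ends in the first east step across
which the slack drops below its value at `p`. Coprimality makes the slacks at two points less than
`b` apart distinct, so no laser ends at a lattice point. `mem_lasers_iff` states this form of
lasers, and the geometry is not needed afterwards. Ranks are replaced by integer weights on the
labels, of which only the block sums matter. In a noncrossing partition the blocks below `B` are
exactly those inside the span of `B`, so a valid ranking is a weighting with positive block sums,
total `a`, and span sums `⌈(j - i + 1) a / b⌉` (`hasValidRanking_iff`). The dual condition
`FillsGaps` asks for the sum `⌊(j - i) a / b⌋` strictly between consecutive elements `i < j` of a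
block. Rotating past the last label turns a gap into the complement of a span and conversely. Since
`a - ⌊k a / b⌋ = ⌈(b - k) a / b⌉`, the two conditions are exchanged there. So a weighting with both
keeps both under rotation (`IsWeighting.rot`). Conversely, if all rotations have valid rankings, the
block sums are carried along by rotation and every gap eventually becomes such a complement
(`fillsGaps_of_rotOrbit`). It remains to match such weightings with paths. The north run lengths of
`D` form one for `π(D)` (`exists_isWeighting_partition`). In the other direction, put the weight of
each block on its minimum and read the weights as north runs: the span and gap inequalities become
comparisons of slacks that force the lasers of this path to cut out exactly the blocks
(`mem_NC_of_isWeighting`). -/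

namespace RationalCatalan

/-! ### Heights, slacks and the combinatorial description of lasers. -/

namespace DyckPath

variable {a b : ℕ}

/-- The height of the east step that ends at the `x`-coordinate `x` (and `0` for `x = 0`). -/
def height (D : DyckPath a b) (x : ℕ) : ℕ :=
  (Finset.univ.filter (fun k => (D.pt k).1 < x)).sup (fun k => (D.pt k).2)

/-- The vertical distance, times `b`, between the line `y = (a/b) x` and the end of the east step
with east `x`-coordinate `x`. -/
def slack (D : DyckPath a b) (x : ℕ) : ℤ := (b : ℤ) * D.height x - a * x

theorem pt_mono (D : DyckPath a b) : Monotone D.pt := by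
  rw [Fin.monotone_iff_le_succ]
  intro i
  rcases D.step i with h | h <;> rw [h] <;> exact le_self_add

theorem snd_le_height (D : DyckPath a b) {k : Fin (a + b + 1)} {x : ℕ} (h : (D.pt k).1 < x) :
    (D.pt k).2 ≤ D.height x :=
  Finset.le_sup (f := fun k => (D.pt k).2) (Finset.mem_filter.mpr ⟨Finset.mem_univ k, h⟩)

theorem height_le (D : DyckPath a b) {x y : ℕ} (h : ∀ k, (D.pt k).1 < x → (D.pt k).2 ≤ y) :
    D.height x ≤ y :=
  Finset.sup_le fun k hk => h k (Finset.mem_filter.mp hk).2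

theorem height_mono (D : DyckPath a b) : Monotone D.height := fun _ _ h =>
  D.height_le fun _ hk => D.snd_le_height (hk.trans_le h)

theorem height_zero (D : DyckPath a b) : D.height 0 = 0 :=
  Nat.le_zero.mp (D.height_le fun _ h => absurd h (Nat.not_lt_zero _))

theorem height_le_a (D : DyckPath a b) (x : ℕ) : D.height x ≤ a := by
  refine D.height_le fun k _ => ?_
  have h := (D.pt_mono (Fin.le_last k)).2
  rwa [D.pt_last] at h

theorem fst_le (D : DyckPath a b) (k : Fin (a + b + 1)) : (D.pt k).1 ≤ b := by
  have h := (D.pt_mono (Fin.le_last k)).1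
  rwa [D.pt_last] at h

theorem IsEast.height_eq {D : DyckPath a b} {k : Fin (a + b)} (hk : D.IsEast k) :
    D.height ((D.pt k.castSucc).1 + 1) = (D.pt k.castSucc).2 := by
  refine le_antisymm (D.height_le fun l hl => ?_) (D.snd_le_height (Nat.lt_succ_self _))
  rcases le_or_gt l k.castSucc with h | h
  · exact (D.pt_mono h).2
  · have h1 := (D.pt_mono (Fin.castSucc_lt_iff_succ_le.mp h)).1
    rw [hk] at h1
    simp only [Prod.fst_add] at h1
    omega

theorem IsNorth.height_le {D : DyckPath a b} {k : Fin (a + b)} (hk : D.IsNorth k) :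
    D.height (D.pt k.castSucc).1 ≤ (D.pt k.castSucc).2 ∧
      (D.pt k.castSucc).2 + 1 ≤ D.height ((D.pt k.castSucc).1 + 1) := by
  constructor
  · refine D.height_le fun l hl => ?_
    rcases le_or_gt l k.castSucc with h | h
    · exact (D.pt_mono h).2
    · have h1 := (D.pt_mono h.le).1
      omega
  · have h := D.snd_le_height (k := k.succ) (x := (D.pt k.castSucc).1 + 1) (by rw [hk]; simp)
    rwa [hk] at h

theorem exists_east (D : DyckPath a b) {x : ℕ} (hx : x < b) :
    ∃ k, D.IsEast k ∧ D.pt k.castSucc = (x, D.height (x + 1)) := by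
  classical
  -- The last point of the path with `x`-coordinate at most `x` is followed by the required east
  -- step.
  set s := Finset.univ.filter (fun k => (D.pt k).1 ≤ x) with hs
  have hne : s.Nonempty := ⟨0, by simp [hs, D.pt_zero]⟩
  have hmem : (D.pt (s.max' hne)).1 ≤ x := (Finset.mem_filter.mp (s.max'_mem hne)).2
  have hmax : ∀ l, (D.pt l).1 ≤ x → l ≤ s.max' hne := fun l hl =>
    s.le_max' l (Finset.mem_filter.mpr ⟨Finset.mem_univ l, hl⟩)
  generalize s.max' hne = k at hmem hmax
  induction k using Fin.lastCases with
  | last => rw [D.pt_last] at hmem; simp only at hmem; omega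
  | cast k =>
    have h1 : x < (D.pt k.succ).1 := by
      by_contra h
      exact absurd (hmax _ (not_lt.mp h)) (not_le.mpr (Fin.castSucc_lt_succ (i := k)))
    rcases D.step k with h | h
    · have h2 : (D.pt k.castSucc).1 = x := by
        rw [h] at h1
        simp only [Prod.fst_add] at h1
        omega
      refine ⟨k, h, Prod.ext h2 ?_⟩
      have h3 := IsEast.height_eq (D := D) (k := k) h
      rw [h2] at h3
      exact h3.symm
    · rw [h] at h1
      simp only [Prod.fst_add] at h1
      omega

theorem slack_nonneg (D : DyckPath a b) {x : ℕ} (hx : x ≤ b) : 0 ≤ D.slack x := by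
  rcases x with _ | x
  · simp [slack, D.height_zero]
  · obtain ⟨k, hk, hp⟩ := D.exists_east hx
    have h := D.above k.succ
    rw [hk, hp] at h
    simp only [Prod.mk_add_mk, add_zero] at h
    unfold slack
    have h' : (a : ℤ) * ((x + 1 : ℕ) : ℤ) ≤ b * D.height (x + 1) := by exact_mod_cast h
    linarith

theorem height_last (D : DyckPath a b) (hb : 0 < b) : D.height b = a := by
  refine le_antisymm (D.height_le_a b) ?_
  have h := D.slack_nonneg le_rfl
  unfold slack at h
  have h' : (b : ℤ) * a ≤ b * D.height b := by linarith
  exact_mod_cast le_of_mul_le_mul_left h' (by exact_mod_cast hb)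

theorem slack_zero (D : DyckPath a b) : D.slack 0 = 0 := by simp [slack, D.height_zero]

theorem slack_last (D : DyckPath a b) (hb : 0 < b) : D.slack b = 0 := by
  rw [slack, D.height_last hb]; ring

/-- Modulo `b` the slack at `x` is `-a * x`, and `a` is invertible. -/
theorem slack_ne (D : DyckPath a b) (hcop : Nat.Coprime a b) {x y : ℕ} (hxy : x < y)
    (hy : y < x + b) : D.slack x ≠ D.slack y := by
  intro h
  unfold slack at h
  have h1 : (b : ℤ) ∣ a * ((y - x : ℕ) : ℤ) := by
    refine ⟨(D.height y : ℤ) - D.height x, ?_⟩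
    rw [Nat.cast_sub hxy.le]
    linarith
  have h2 : b ∣ a * (y - x) := by exact_mod_cast h1
  have h3 := Nat.le_of_dvd (by omega) (hcop.symm.dvd_of_dvd_mul_left h2)
  omega

theorem isValley_iff (D : DyckPath a b) (P : ℕ × ℕ) :
    D.IsValley P ↔ 1 ≤ P.1 ∧ P.1 < b ∧ P.2 = D.height P.1 ∧ D.height P.1 < D.height (P.1 + 1) := by
  constructor
  · rintro ⟨k, l, hkl, rfl, hk, hl⟩
    have h1 : D.pt l.castSucc = D.pt k.castSucc + (1, 0) := by rw [← hkl]; exact hk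
    have h2 := hk.height_eq
    have h3 := hl.height_le
    rw [h1] at h3 ⊢
    simp only [Prod.fst_add, Prod.snd_add, add_zero] at h3 ⊢
    refine ⟨by omega, ?_, h2.symm, by omega⟩
    by_contra hb
    have h4 := D.fst_le k.succ
    rw [hk] at h4
    simp only [Prod.fst_add] at h4
    have h5 := D.height_le_a ((D.pt k.castSucc).1 + 1 + 1)
    have h6 := D.height_last (by omega)
    have h7 : (D.pt k.castSucc).1 + 1 = b := by omega
    rw [h7] at h3 h5
    omega
  · rintro ⟨h1, h2, h3, h4⟩
    obtain ⟨x, y⟩ := P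
    simp only at h1 h2 h3 h4
    obtain ⟨x, rfl⟩ : ∃ z, x = z + 1 := ⟨x - 1, by omega⟩
    obtain ⟨k, hk, hp⟩ := D.exists_east (x := x) (by omega)
    have hk' : D.pt k.succ = (x + 1, y) := by rw [hk, hp, h3]; rfl
    have hl : k.succ ≠ Fin.last _ := by
      intro h
      rw [h, D.pt_last] at hk'
      have := congrArg Prod.fst hk'
      simp only at this
      omega
    obtain ⟨l, hl⟩ := Fin.exists_castSucc_eq.mpr hl
    refine ⟨k, l, hl.symm, by rw [hl, hk'], hk, ?_⟩
    rcases D.step l with h | h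
    · have h5 := IsEast.height_eq (D := D) (k := l) h
      rw [hl, hk'] at h5
      simp only at h5
      omega
    · exact h

/-- Only a lower bound is kept on north steps: it suffices to exclude an early hit of a laser. -/
theorem support_cases (D : DyckPath a b) {Q : ℝ × ℝ} (hQ : Q ∈ D.support) :
    (∃ x : ℕ, Q.2 = D.height (x + 1) ∧ (x : ℝ) ≤ Q.1 ∧ Q.1 ≤ x + 1) ∨
      ∃ x : ℕ, Q.1 = x ∧ (D.height x : ℝ) ≤ Q.2 := by
  obtain ⟨k, u, v, hu, hv, huv, rfl⟩ := hQ
  rcases D.step k with h | h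
  · left
    have h1 := IsEast.height_eq (D := D) (k := k) h
    refine ⟨(D.pt k.castSucc).1, ?_, ?_, ?_⟩
    · rw [h1, h]
      simp only [toPlane, Prod.snd_add, Prod.smul_snd, smul_eq_mul, add_zero]
      rw [← add_mul, huv, one_mul]
    all_goals
      rw [h]
      simp only [toPlane, Prod.fst_add, Prod.smul_fst, smul_eq_mul]
      push_cast
      nlinarith
  · right
    have h1 := (IsNorth.height_le (D := D) (k := k) h).1
    have h1' : (D.height (D.pt k.castSucc).1 : ℝ) ≤ (D.pt k.castSucc).2 := by exact_mod_cast h1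
    refine ⟨(D.pt k.castSucc).1, ?_, ?_⟩
    · rw [h]
      simp only [toPlane, Prod.fst_add, Prod.smul_fst, smul_eq_mul, add_zero]
      rw [← add_mul, huv, one_mul]
    · rw [h]
      simp only [toPlane, Prod.snd_add, Prod.smul_snd, smul_eq_mul]
      push_cast
      nlinarith

theorem IsEast.mem_openSegment_iff {D : DyckPath a b} {k : Fin (a + b)} (hk : D.IsEast k)
    (Q : ℝ × ℝ) :
    Q ∈ openSegment ℝ (toPlane (D.pt k.castSucc)) (toPlane (D.pt k.succ)) ↔
      ((D.pt k.castSucc).1 : ℝ) < Q.1 ∧ Q.1 < (D.pt k.castSucc).1 + 1 ∧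
        Q.2 = (D.pt k.castSucc).2 := by
  rw [show D.pt k.succ = _ from hk]
  constructor
  · rintro ⟨u, v, hu, hv, huv, rfl⟩
    simp only [toPlane, Prod.fst_add, Prod.snd_add, Prod.smul_fst, Prod.smul_snd, smul_eq_mul]
    push_cast
    refine ⟨by nlinarith, by nlinarith, ?_⟩
    rw [add_zero, ← add_mul, huv, one_mul]
  · rintro ⟨h1, h2, h3⟩
    refine ⟨(D.pt k.castSucc).1 + 1 - Q.1, Q.1 - (D.pt k.castSucc).1, by linarith, by linarith,
      by ring, Prod.ext ?_ ?_⟩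
    · simp only [toPlane, Prod.fst_add, Prod.smul_fst, smul_eq_mul]
      push_cast
      ring
    · simp only [toPlane, Prod.snd_add, Prod.smul_snd, smul_eq_mul]
      push_cast
      rw [h3]
      ring

/-- The laser fired from the valley with `x`-coordinate `p` meets the path first in the interior of
the east step with west `x`-coordinate `m`, where `m + 1` is the first point of smaller slack. -/
theorem isLeast_hits (D : DyckPath a b) (ha : 0 < a) (hcop : Nat.Coprime a b) {p m : ℕ}
    (hp : D.height p < D.height (p + 1)) (hpm : p ≤ m) (hm : m < b) (hp1 : 1 ≤ p)
    (hlt : D.slack (m + 1) < D.slack p) (hle : ∀ t, p ≤ t → t ≤ m → D.slack p ≤ D.slack t) :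
    ∃ t : ℝ, IsLeast (D.hits (p, D.height p)) t ∧ (m : ℝ) < p + t * b ∧ p + t * b < m + 1 ∧
      (D.height p : ℝ) + t * a = D.height (m + 1) := by
  have ha' : (0 : ℝ) < a := by exact_mod_cast ha
  have hb' : (0 : ℝ) < b := by exact_mod_cast (by omega : 0 < b)
  have hstrict : ∀ t, p < t → t ≤ m → D.slack p < D.slack t := fun t h1 h2 =>
    lt_of_le_of_ne (hle t h1.le h2) (D.slack_ne hcop h1 (by omega))
  have hslack : ∀ x, (D.slack x : ℝ) = b * D.height x - a * x := fun x => by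
    unfold slack; push_cast; rfl
  -- The parameter at which the ray reaches the height of the east step over `[m, m + 1]`.
  set t : ℝ := ((D.height (m + 1) : ℝ) - D.height p) / a with ht
  have hta : t * a = (D.height (m + 1) : ℝ) - D.height p := div_mul_cancel₀ _ ha'.ne'
  -- The quantity `b * y - a * x` equals the slack of the valley all along the ray.
  have hkey : ∀ s : ℝ, a * (p + s * b) = b * (D.height p + s * a) - D.slack p := fun s => by
    rw [hslack]; ring
  have h1 : (p : ℝ) + t * b < m + 1 := by
    have h2 : (D.slack (m + 1) : ℝ) < D.slack p := by exact_mod_cast hlt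
    have h3 := hkey t
    rw [hta] at h3
    rw [hslack (m + 1)] at h2
    push_cast at h2
    nlinarith
  have h2 : (m : ℝ) < p + t * b := by
    have h3 := hkey t
    rw [hta] at h3
    have h4 : (D.slack p : ℝ) < b * D.height (m + 1) - a * m := by
      rcases hpm.eq_or_lt with rfl | h
      · rw [hslack]
        have : (D.height p : ℝ) < D.height (p + 1) := by exact_mod_cast hp
        nlinarith
      · have h5 : (D.slack p : ℝ) < D.slack m := by exact_mod_cast hstrict m h le_rfl
        have h6 : (D.height m : ℝ) ≤ D.height (m + 1) := by
          exact_mod_cast D.height_mono (Nat.le_succ m)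
        rw [hslack m] at h5
        nlinarith
    nlinarith
  have htpos : 0 < t := by
    have h3 : (p : ℝ) ≤ m := by exact_mod_cast hpm
    by_contra h
    nlinarith [not_lt.mp h]
  refine ⟨t, ⟨⟨htpos, ?_⟩, ?_⟩, h2, h1, by rw [hta]; ring⟩
  · obtain ⟨k, hk, hpt⟩ := D.exists_east hm
    refine ⟨k, openSegment_subset_segment ℝ _ _ ((hk.mem_openSegment_iff _).mpr ?_)⟩
    rw [hpt]
    exact ⟨h2, h1, by rw [hta]; simp⟩
  · rintro s ⟨hs, hsup⟩
    have hxs : (p : ℝ) < p + s * b := by nlinarith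
    have hks := hkey s
    have hkt := hkey t
    suffices h : (p : ℝ) + t * b ≤ p + s * b by
      by_contra hlt'
      nlinarith [not_le.mp hlt']
    -- Path points beyond the valley and before the final east step have `b * y - a * x` strictly
    -- above the slack of the valley, so they are off the ray.
    rcases D.support_cases hsup with ⟨x, hy, hx1, hx2⟩ | ⟨x, hx, hy⟩
    · simp only at hy hx1 hx2
      have hpx : p ≤ x := by
        have : (p : ℝ) < x + 1 := by linarith
        have : p < x + 1 := by exact_mod_cast this
        omega
      rcases le_or_gt m x with h | h
      · have h6 : (D.height (m + 1) : ℝ) ≤ D.height (x + 1) := by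
          exact_mod_cast D.height_mono (Nat.succ_le_succ h)
        have h7 : t * a ≤ s * a := by linarith
        have h8 : t ≤ s := le_of_mul_le_mul_right h7 ha'
        nlinarith
      · exfalso
        have h5 : (D.slack p : ℝ) < D.slack (x + 1) := by
          exact_mod_cast hstrict (x + 1) (by omega) h
        rw [hslack (x + 1)] at h5
        push_cast at h5
        rw [hy] at hks
        nlinarith
    · simp only at hx hy
      rw [hx]
      rcases le_or_gt x m with h | h
      · exfalso
        have hpx : p < x := by rw [hx] at hxs; exact_mod_cast hxs
        have h5 : (D.slack p : ℝ) < D.slack x := by exact_mod_cast hstrict x hpx h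
        rw [hslack x] at h5
        rw [hx] at hks
        nlinarith
      · have : (m : ℝ) + 1 ≤ x := by exact_mod_cast h
        linarith

/-- The level `c` is free because lasers use `slack p`, while block maxima use `slack p + 1`. -/
theorem exists_first_slack_lt (D : DyckPath a b) {p : ℕ} {c : ℤ} (hp : p < b)
    (hc : D.slack b < c) :
    ∃ m, p ≤ m ∧ m < b ∧ D.slack (m + 1) < c ∧ ∀ t, p < t → t ≤ m → c ≤ D.slack t := by
  classical
  have hex : ∃ m, p ≤ m ∧ D.slack (m + 1) < c :=
    ⟨b - 1, by omega, by rwa [Nat.sub_add_cancel (by omega)]⟩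
  have hspec := Nat.find_spec hex
  refine ⟨Nat.find hex, hspec.1, ?_, hspec.2, fun t h1 h2 => ?_⟩
  · have := Nat.find_min' hex (m := b - 1)
      ⟨by omega, by rwa [Nat.sub_add_cancel (by omega)]⟩
    omega
  · by_contra h
    have := Nat.find_min hex (m := t - 1) (by omega)
    rw [Nat.sub_add_cancel (by omega)] at this
    exact this ⟨by omega, not_le.mp h⟩

/-- The first descent below the level of the valley gives one hit that is least; since the least hit
is unique, any laser must end there. -/
theorem mem_lasers_iff (D : DyckPath a b) (ha : 0 < a) (hcop : Nat.Coprime a b) (q : ℕ × ℕ) :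
    q ∈ D.lasers ↔ 1 ≤ q.1 ∧ D.height q.1 < D.height (q.1 + 1) ∧ q.1 ≤ q.2 ∧ q.2 < b ∧
      D.slack (q.2 + 1) < D.slack q.1 ∧
        ∀ t, q.1 ≤ t → t ≤ q.2 → D.slack q.1 ≤ D.slack t := by
  obtain ⟨p, m⟩ := q
  constructor
  · rintro ⟨P, hP, rfl, t, ht, k, hk, rfl, hmem⟩
    obtain ⟨h1, h2, h3, h4⟩ := (D.isValley_iff P).mp hP
    have hpos : D.slack b < D.slack P.1 := by
      rw [D.slack_last (by omega)]
      refine lt_of_le_of_ne (D.slack_nonneg h2.le) ?_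
      rw [← D.slack_zero]
      exact D.slack_ne hcop h1 (by omega)
    obtain ⟨m, hm1, hm2, hm3, hm4⟩ := D.exists_first_slack_lt h2 hpos
    have hm5 : ∀ t, P.1 ≤ t → t ≤ m → D.slack P.1 ≤ D.slack t := fun t h h' =>
      h.eq_or_lt.elim (fun e => e ▸ le_rfl) (fun e => hm4 t e h')
    obtain ⟨s, hs, hs1, hs2, -⟩ := D.isLeast_hits ha hcop h4 hm1 hm2 h1 hm3 hm5
    have hPe : P = (P.1, D.height P.1) := Prod.ext rfl h3
    rw [hPe] at ht
    obtain rfl := ht.unique hs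
    obtain ⟨h5, h6, -⟩ := (hk.mem_openSegment_iff _).mp hmem
    simp only at h5 h6
    have e : (D.pt k.castSucc).1 = m := by
      have e1 : ((D.pt k.castSucc).1 : ℝ) < m + 1 := by linarith
      have e2 : (m : ℝ) < (D.pt k.castSucc).1 + 1 := by linarith
      have e1' : (D.pt k.castSucc).1 < m + 1 := by exact_mod_cast e1
      have e2' : m < (D.pt k.castSucc).1 + 1 := by exact_mod_cast e2
      omega
    simp only [e]
    exact ⟨h1, h4, hm1, hm2, hm3, hm5⟩
  · rintro ⟨h1, h2, h3, h4, h5, h6⟩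
    simp only at h1 h2 h3 h4 h5 h6
    obtain ⟨t, ht, ht1, ht2, ht3⟩ := D.isLeast_hits ha hcop h2 h3 h4 h1 h5 h6
    obtain ⟨k, hk, hpt⟩ := D.exists_east h4
    refine ⟨(p, D.height p), (D.isValley_iff _).mpr ⟨h1, by simp only; omega, rfl, h2⟩, rfl, t, ht,
      k, hk, by rw [hpt], (hk.mem_openSegment_iff _).mpr ?_⟩
    rw [hpt]
    exact ⟨ht1, ht2, ht3⟩

/-- Two labels lie in the same block of `π(D)` iff no laser separates them. -/
theorem partition_part_eq_iff (D : DyckPath a b) (i j : Fin (b - 1)) :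
    D.partition.part i = D.partition.part j ↔
      ∀ q ∈ D.lasers, (q.1 ≤ i.val ∧ i.val < q.2 ↔ q.1 ≤ j.val ∧ j.val < q.2) := by
  classical
  have h1 : D.partition.part i = D.partition.part j ↔ D.visibility i j := by
    rw [← Finpartition.mem_part_iff_part_eq_part _ (Finset.mem_univ i) (Finset.mem_univ j),
      partition, Finpartition.mem_part_ofSetoid_iff_rel]
    exact ⟨fun h => D.visibility.symm h, fun h => D.visibility.symm h⟩
  rw [h1]
  refine forall₂_congr fun q _ => ?_
  -- Index `i` is the label `i + 1`, so the pocket `p + 1, …, m` becomes `p ≤ i < m`.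
  simp only [InPocket, Nat.lt_succ_iff, Nat.succ_le_iff]

end DyckPath

/-! ### Paths with prescribed heights. -/

namespace DyckPath

variable {a b : ℕ}

/-- Every admissible height function is the height function of a Dyck path. -/
theorem exists_height_eq {H : ℕ → ℕ} (hmono : Monotone H) (h0 : H 0 = 0) (hb : H b = a)
    (habove : ∀ x ≤ b, a * x ≤ b * H x) : ∃ D : DyckPath a b, ∀ x ≤ b, D.height x = H x := by
  -- The east step leaving column `x` is step number `x + H (x + 1)`, counted from zero; `X k` below
  -- counts the columns whose number is less than `k`, hence is the `x`-coordinate after `k` steps.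
  have hidx : ∀ x y, x < y → x + H (x + 1) < y + H (y + 1) := fun x y h =>
    add_lt_add_of_lt_of_le h (hmono (by omega))
  have hex : ∀ k, ∃ c ≤ b, (∀ x < c, x + H (x + 1) < k) ∧ (c < b → k ≤ c + H (c + 1)) := by
    classical
    intro k
    have hE : ∃ c, b ≤ c ∨ k ≤ c + H (c + 1) := ⟨b, Or.inl le_rfl⟩
    refine ⟨Nat.find hE, Nat.find_min' hE (Or.inl le_rfl), fun x hx => ?_, fun h => ?_⟩
    · have := Nat.find_min hE hx
      omega
    · have := Nat.find_spec hE
      omega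
  choose X hXb hX1 hX2 using hex
  have hle : ∀ k, X k + H (X k) ≤ k := by
    intro k
    rcases hc : X k with _ | c
    · omega
    · have := hX1 k c (by omega)
      omega
  have hstep : ∀ k, X (k + 1) = X k ∨ (X (k + 1) = X k + 1 ∧ k = X k + H (X k + 1)) := by
    intro k
    have h1 := hX1 k
    have h2 := hX1 (k + 1)
    have h3 := hX2 k
    have h4 := hX2 (k + 1)
    have h5 := hXb k
    have h6 := hXb (k + 1)
    rcases lt_trichotomy (X (k + 1)) (X k) with h | h | h
    · have := h1 _ h
      omega
    · exact Or.inl h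
    · have h7 := h2 _ h
      rcases Nat.lt_or_ge (X k + 1) (X (k + 1)) with h8 | h8
      · have := h2 _ h8
        have := hidx (X k) (X k + 1) (by omega)
        omega
      · omega
  let D : DyckPath a b :=
    { pt := fun k => (X k.val, k.val - X k.val)
      pt_zero := by
        have := hle 0
        simp only [Fin.val_zero, Prod.mk.injEq]
        omega
      pt_last := by
        have h1 := hXb (a + b)
        have h2 := hX2 (a + b)
        have h3 : X (a + b) = b := by
          by_contra h
          have := hmono (show X (a + b) + 1 ≤ b by omega)
          omega
        simp only [Fin.val_last, Prod.mk.injEq]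
        omega
      step := by
        intro k
        have h1 := hle k.val
        have h2 := hle (k.val + 1)
        simp only [Fin.val_succ, Fin.val_castSucc, Prod.mk_add_mk, Prod.mk.injEq]
        rcases hstep k.val with h | ⟨h, -⟩ <;> omega
      above := by
        intro k
        refine (habove _ (hXb _)).trans (Nat.mul_le_mul_left _ ?_)
        have := hle k.val
        simp only
        omega }
  refine ⟨D, fun x hx => ?_⟩
  rcases x with _ | x
  · rw [D.height_zero, h0]
  · obtain ⟨k, hk, hp⟩ := D.exists_east hx
    have h1 : X k.val = x := congrArg Prod.fst hp
    have h2 : k.val - X k.val = D.height (x + 1) := congrArg Prod.snd hp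
    have h3 : X (k.val + 1) = X k.val + 1 := congrArg Prod.fst hk
    rcases hstep k.val with h | ⟨-, h⟩
    · omega
    · rw [h1] at h h2
      omega

end DyckPath

/-! ### Spans and gaps in noncrossing partitions, and sums over unions of blocks. -/

variable {n : ℕ}

theorem part_mem_parts (π : SetPartition n) (i : Fin n) : π.part i ∈ π.parts :=
  π.part_mem.mpr (Finset.mem_univ i)

theorem mem_part_iff (π : SetPartition n) {i j : Fin n} : i ∈ π.part j ↔ π.part i = π.part j :=
  π.mem_part_iff_part_eq_part (Finset.mem_univ i) (Finset.mem_univ j)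

theorem mem_own_part (π : SetPartition n) (i : Fin n) : i ∈ π.part i :=
  (mem_part_iff π).mpr rfl

theorem exists_part_eq {π : SetPartition n} {B : Finset (Fin n)} (hB : B ∈ π.parts) :
    ∃ i, π.part i = B := by
  obtain ⟨i, hi⟩ := π.nonempty_of_mem_parts hB
  exact ⟨i, π.part_eq_of_mem hB hi⟩

/-- `i` and `j` are the smallest and the largest element of one block. -/
structure IsSpan (π : SetPartition n) (i j : Fin n) : Prop where
  part_eq : π.part i = π.part j
  le : ∀ k, π.part k = π.part i → i ≤ k ∧ k ≤ j

/-- `i < j` are consecutive elements of one block. -/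
structure IsConsecutive (π : SetPartition n) (i j : Fin n) : Prop where
  lt : i < j
  part_eq : π.part i = π.part j
  gap : ∀ k, π.part k = π.part i → k ≤ i ∨ j ≤ k

theorem exists_isSpan (π : SetPartition n) (k : Fin n) :
    ∃ i j, IsSpan π i j ∧ π.part i = π.part k := by
  have hne : (π.part k).Nonempty := ⟨k, mem_own_part π k⟩
  have h1 := (mem_part_iff π).mp ((π.part k).min'_mem hne)
  have h2 := (mem_part_iff π).mp ((π.part k).max'_mem hne)
  refine ⟨(π.part k).min' hne, (π.part k).max' hne, ⟨h1.trans h2.symm, fun l hl => ?_⟩, h1⟩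
  have hl' : l ∈ π.part k := (mem_part_iff π).mpr (hl.trans h1)
  exact ⟨Finset.min'_le _ _ hl', Finset.le_max' _ _ hl'⟩

theorem IsSpan.left_le_right {π : SetPartition n} {i j : Fin n} (h : IsSpan π i j) : i ≤ j :=
  (h.le i rfl).2

theorem IsSpan.minLabel_eq {π : SetPartition n} {i j : Fin n} (h : IsSpan π i j) :
    minLabel (π.part i) = i.val + 1 := by
  have hne : (π.part i).Nonempty := ⟨i, mem_own_part π i⟩
  rw [minLabel, dif_pos hne]
  congr 2
  refine le_antisymm (Finset.min'_le _ _ (mem_own_part π i)) ?_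
  exact (h.le _ ((mem_part_iff π).mp (Finset.min'_mem _ hne))).1

theorem IsSpan.maxLabel_eq {π : SetPartition n} {i j : Fin n} (h : IsSpan π i j) :
    maxLabel (π.part i) = j.val + 1 := by
  have hne : (π.part i).Nonempty := ⟨i, mem_own_part π i⟩
  rw [maxLabel, dif_pos hne]
  congr 2
  refine le_antisymm ?_ (Finset.le_max' _ _ ((mem_part_iff π).mpr h.part_eq.symm))
  exact (h.le _ ((mem_part_iff π).mp (Finset.max'_mem _ hne))).2

/-- Turns the sums over `⪯` in the rank recursion into sums over intervals of labels. -/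
theorem IsSpan.blockLE_iff {π : SetPartition n} {i j : Fin n} (h : IsSpan π i j)
    {B : Finset (Fin n)} (hB : B ∈ π.parts) :
    BlockLE B (π.part i) ↔ B ⊆ Finset.Icc i j := by
  obtain ⟨k, rfl⟩ := exists_part_eq hB
  obtain ⟨i', j', h', he⟩ := exists_isSpan π k
  rw [← he]
  rw [BlockLE, Set.Icc_subset_Icc_iff (minLabel_le_maxLabel _), h.minLabel_eq, h.maxLabel_eq,
    h'.minLabel_eq, h'.maxLabel_eq]
  constructor
  · rintro ⟨h1, h2⟩ x hx
    have := h'.le x ((mem_part_iff π).mp hx)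
    rw [Finset.mem_Icc]
    omega
  · intro hs
    have h1 := Finset.mem_Icc.mp (hs (mem_own_part π i'))
    have h2 := Finset.mem_Icc.mp (hs ((mem_part_iff π).mpr h'.part_eq.symm))
    omega

/-- The span of a block of a noncrossing partition is a union of blocks. -/
theorem IsSpan.mem_Icc_of_part_eq {π : SetPartition n} (hπ : IsNoncrossing π) {i j : Fin n}
    (h : IsSpan π i j) {x y : Fin n} (hxy : π.part x = π.part y) (hx : x ∈ Finset.Icc i j) :
    y ∈ Finset.Icc i j := by
  rw [Finset.mem_Icc] at hx ⊢
  by_cases hxi : π.part x = π.part i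
  · exact h.le y (hxy.symm.trans hxi)
  have h1 : i ≠ x := fun e => hxi (e ▸ rfl)
  have h2 : j ≠ x := fun e => hxi (by rw [h.part_eq, e])
  have h3 : i < x := lt_of_le_of_ne hx.1 h1
  have h4 : x < j := lt_of_le_of_ne hx.2 h2.symm
  by_contra hy
  rcases lt_or_ge y i with h5 | h5
  · obtain ⟨e1, e2, e3⟩ := hπ y i x j h5 h3 h4 hxy.symm h.part_eq
    exact hxi e2.symm
  · have h6 : j < y := not_le.mp fun h6 => hy ⟨h5, h6⟩
    exact hxi (hπ i x j y h3 h4 h6 h.part_eq hxy).1.symm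

/-- The gap between consecutive elements of a block of a noncrossing partition is a union of
blocks. -/
theorem IsConsecutive.mem_Ioo_of_part_eq {π : SetPartition n} (hπ : IsNoncrossing π)
    {i j : Fin n} (h : IsConsecutive π i j) {x y : Fin n} (hxy : π.part x = π.part y)
    (hx : x ∈ Finset.Ioo i j) : y ∈ Finset.Ioo i j := by
  rw [Finset.mem_Ioo] at hx ⊢
  have hxi : π.part x ≠ π.part i := fun e => by
    rcases h.gap x e with h1 | h1
    · exact absurd hx.1 (not_lt.mpr h1)
    · exact absurd hx.2 (not_lt.mpr h1)
  have h1 : y ≠ i := fun e => hxi (e ▸ hxy)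
  have h2 : y ≠ j := fun e => hxi (by rw [h.part_eq, ← e, hxy])
  by_contra hy
  rcases lt_or_ge i y with h3 | h3
  · have h4 : j < y := lt_of_le_of_ne (not_lt.mp fun h6 => hy ⟨h3, h6⟩) h2.symm
    exact hxi (hπ i x j y hx.1 hx.2 h4 h.part_eq hxy).1.symm
  · have h4 : y < i := lt_of_le_of_ne h3 h1
    obtain ⟨e1, e2, e3⟩ := hπ y i x j h4 hx.1 hx.2 hxy.symm h.part_eq
    exact hxi e2.symm

/-- The sum over a union of blocks, block by block. -/
theorem sum_eq_sum_parts (π : SetPartition n) (w : Fin n → ℤ) {A : Finset (Fin n)}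
    (hA : ∀ x y, π.part x = π.part y → x ∈ A → y ∈ A) :
    ∑ x ∈ A, w x = ∑ B ∈ π.parts with B ⊆ A, ∑ x ∈ B, w x := by
  rw [← Finset.sum_fiberwise_of_maps_to (s := A) (t := π.parts.filter (· ⊆ A)) (g := π.part)]
  · refine Finset.sum_congr rfl fun B hB => Finset.sum_congr ?_ fun _ _ => rfl
    obtain ⟨hB1, hB2⟩ := Finset.mem_filter.mp hB
    ext x
    rw [Finset.mem_filter, π.part_eq_iff_mem hB1]
    exact ⟨fun h => h.2, fun h => ⟨hB2 h, h⟩⟩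
  · intro x hx
    exact Finset.mem_filter.mpr
      ⟨part_mem_parts π x, fun y hy => hA x y ((mem_part_iff π).mp hy).symm hx⟩

/-- If the sums over the spans vanish, then so do the sums over the blocks. -/
theorem sum_part_eq_zero {π : SetPartition n} (hπ : IsNoncrossing π) {d : Fin n → ℤ} (c : ℕ)
    (hd : ∀ i j, IsSpan π i j → j.val < c → ∑ x ∈ Finset.Icc i j, d x = 0) {i j : Fin n}
    (h : IsSpan π i j) (hj : j.val < c) : ∑ x ∈ π.part i, d x = 0 := by
  -- Every other block inside the span has a shorter span that also ends before `c`, so by induction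
  -- only the block itself contributes to the span sum.
  induction hm : j.val - i.val using Nat.strong_induction_on generalizing i j with
  | _ m ih =>
    subst hm
    have h1 := hd i j h hj
    rw [sum_eq_sum_parts π d (fun x y => h.mem_Icc_of_part_eq hπ)] at h1
    rw [← h1]
    symm
    refine Finset.sum_eq_single_of_mem _ (Finset.mem_filter.mpr ⟨part_mem_parts π i, fun x hx =>
      Finset.mem_Icc.mpr (h.le x ((mem_part_iff π).mp hx))⟩) fun B hB hne => ?_
    obtain ⟨hB1, hB2⟩ := Finset.mem_filter.mp hB
    obtain ⟨k, rfl⟩ := exists_part_eq hB1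
    obtain ⟨i', j', h', he⟩ := exists_isSpan π k
    rw [← he] at hB2 hne ⊢
    have h2 := Finset.mem_Icc.mp (hB2 (mem_own_part π i'))
    have h3 := Finset.mem_Icc.mp (hB2 ((mem_part_iff π).mpr h'.part_eq.symm))
    have h4 : i ≠ i' := fun e => hne (e ▸ rfl)
    have h5 := h'.left_le_right
    refine ih _ ?_ h' (by omega) rfl
    omega

/-! ### Weights in place of ranks. -/

/-- Weights on the labels whose sums over the blocks are the ranks of a valid ranking. -/
structure IsWeighting (a b : ℕ) (π : SetPartition n) (w : Fin n → ℤ) : Prop where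
  pos : ∀ i, 0 < ∑ x ∈ π.part i, w x
  total : ∑ x, w x = a
  span : ∀ i j, IsSpan π i j →
    (a : ℤ) * (j - i + 1) ≤ b * ∑ x ∈ Finset.Icc i j, w x ∧
      (b : ℤ) * ∑ x ∈ Finset.Icc i j, w x < a * (j - i + 1) + b

/-- The sums over the gaps between consecutive elements of a block are the largest possible. -/
def FillsGaps (a b : ℕ) (π : SetPartition n) (w : Fin n → ℤ) : Prop :=
  ∀ i j, IsConsecutive π i j →
    (b : ℤ) * ∑ x ∈ Finset.Ioo i j, w x ≤ a * (j - i) ∧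
      (a : ℤ) * (j - i) < b * ∑ x ∈ Finset.Ioo i j, w x + b

theorem eq_rankSum_iff {a b : ℕ} (hb : 0 < b) {π : SetPartition n} {i j : Fin n}
    (h : IsSpan π i j) (s : ℤ) :
    s = rankSum a b (π.part i) ↔
      (a : ℤ) * (j - i + 1) ≤ b * s ∧ (b : ℤ) * s < a * (j - i + 1) + b := by
  have hb' : (0 : ℚ) < b := by exact_mod_cast hb
  rw [rankSum, h.minLabel_eq, h.maxLabel_eq, eq_comm, Int.ceil_eq_iff]
  have e : ((j.val + 1 : ℕ) : ℚ) - ((i.val + 1 : ℕ) : ℚ) + 1 = (j.val : ℚ) - i.val + 1 := by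
    push_cast; ring
  rw [e, ← mul_div_assoc, lt_div_iff₀ hb', div_le_iff₀ hb', and_comm]
  refine and_congr ?_ ?_
  · rw [← Int.cast_le (R := ℚ)]
    push_cast
    constructor <;> intro h <;> linarith
  · rw [← Int.cast_lt (R := ℚ)]
    push_cast
    constructor <;> intro h <;> linarith

open Classical in
theorem sum_rank_eq (a b : ℕ) {π : SetPartition n} {w : Fin n → ℤ}
    (hw : ∀ B : {B // B ∈ π.parts}, rank a b π B = ∑ x ∈ B.1, w x)
    (p : Finset (Fin n) → Prop) :
    ∑ B : {B // B ∈ π.parts} with p B.1, rank a b π B = ∑ B ∈ π.parts with p B, ∑ x ∈ B, w x := by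
  rw [Finset.sum_filter, Finset.sum_filter, ← Finset.sum_coe_sort π.parts]
  exact Finset.sum_congr rfl fun B _ => by rw [hw B]

/-- A function on the blocks is the block sum of weights supported on the minima of the blocks. -/
theorem exists_weight (π : SetPartition n) (r : {B // B ∈ π.parts} → ℤ) :
    ∃ w : Fin n → ℤ, (∀ B, r B = ∑ x ∈ B.1, w x) ∧
      ∀ x y, π.part y = π.part x → y < x → w x = 0 := by
  classical
  refine ⟨fun x => if ∀ y, π.part y = π.part x → x ≤ y then r ⟨π.part x, part_mem_parts π x⟩ else 0,
    ?_, fun x y hxy hlt => if_neg fun h => absurd (h y hxy) (not_le.mpr hlt)⟩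
  rintro ⟨B, hB⟩
  obtain ⟨k, rfl⟩ := exists_part_eq hB
  obtain ⟨i, j, h, he⟩ := exists_isSpan π k
  symm
  rw [Finset.sum_eq_single_of_mem i]
  · rw [if_pos fun y hy => (h.le y hy).1]
    congr 2
  · exact (mem_part_iff π).mpr he
  · intro x hx hne
    rw [if_neg]
    intro h1
    have h2 := (mem_part_iff π).mp hx
    exact hne (le_antisymm (h1 i (he.trans h2.symm)) (h.le x (h2.trans he.symm)).1)

theorem sum_subset_Icc_eq {a b : ℕ} {π : SetPartition n} (hπ : IsNoncrossing π) {w : Fin n → ℤ}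
    (hw : ∀ B : {B // B ∈ π.parts}, rank a b π B = ∑ x ∈ B.1, w x) {i j : Fin n}
    (h : IsSpan π i j) : ∑ x ∈ Finset.Icc i j, w x = rankSum a b (π.part i) := by
  classical
  rw [← sum_rank a b π ⟨π.part i, part_mem_parts π i⟩, sum_rank_eq a b hw (BlockLE · (π.part i)),
    sum_eq_sum_parts π w (fun x y => h.mem_Icc_of_part_eq hπ)]
  refine Finset.sum_congr (Finset.filter_congr fun B hB => (h.blockLE_iff hB).symm) fun _ _ => rfl

theorem sum_all_eq {a b : ℕ} {π : SetPartition n} {w : Fin n → ℤ}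
    (hw : ∀ B : {B // B ∈ π.parts}, rank a b π B = ∑ x ∈ B.1, w x) :
    ∑ B : {B // B ∈ π.parts}, rank a b π B = ∑ x, w x := by
  classical
  have h := sum_rank_eq a b hw (fun _ => True)
  rw [Finset.filter_true, Finset.filter_true] at h
  rw [h, sum_eq_sum_parts π w (A := Finset.univ) fun _ _ _ _ => Finset.mem_univ _]
  refine Finset.sum_congr ?_ fun _ _ => rfl
  exact (Finset.filter_true_of_mem fun B _ => Finset.subset_univ B).symm

/-- The span of a block is the union of the blocks below it, so the rank recursion prescribes span
sums. These determine the block sums, hence any weighting with the right span sums has the ranks as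
block sums. -/
theorem hasValidRanking_iff {a b : ℕ} (hb : 0 < b) {π : SetPartition n} (hπ : IsNoncrossing π) :
    HasValidRanking a b π ↔ ∃ w, IsWeighting a b π w := by
  obtain ⟨v, hv, -⟩ := exists_weight π (rank a b π)
  constructor
  · rintro ⟨hpos, htot⟩
    refine ⟨v, fun i => ?_, by rw [← sum_all_eq hv, htot], fun i j h => ?_⟩
    · rw [← hv ⟨π.part i, part_mem_parts π i⟩]
      exact hpos _
    · exact (eq_rankSum_iff hb h _).mp (sum_subset_Icc_eq hπ hv h)
  · rintro ⟨w, hw⟩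
    have hd : ∀ i j, IsSpan π i j → ∑ x ∈ π.part i, (v x - w x) = 0 := fun i j h =>
      sum_part_eq_zero hπ n (fun i j h _ => by
        rw [Finset.sum_sub_distrib, sum_subset_Icc_eq hπ hv h,
          (eq_rankSum_iff hb h _).mpr (hw.span i j h), sub_self]) h j.isLt
    have hr : ∀ B : {B // B ∈ π.parts}, rank a b π B = ∑ x ∈ B.1, w x := by
      rintro ⟨B, hB⟩
      obtain ⟨k, rfl⟩ := exists_part_eq hB
      obtain ⟨i, j, h, he⟩ := exists_isSpan π k
      have h1 := hd i j h
      rw [Finset.sum_sub_distrib, he] at h1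
      rw [hv]
      linarith
    refine ⟨fun B => ?_, by rw [sum_all_eq hr, hw.total]⟩
    obtain ⟨i, hi⟩ := exists_part_eq B.2
    rw [hr, ← hi]
    exact hw.pos i

/-! ### Rotation exchanges spans and gaps. -/

section Rotation

variable {m : ℕ}

theorem val_finRotate (x : Fin (m + 1)) :
    (x.val = m ∧ (finRotate (m + 1) x).val = 0) ∨
      (x.val < m ∧ (finRotate (m + 1) x).val = x.val + 1) := by
  rcases eq_or_ne x (Fin.last m) with rfl | h
  · exact Or.inl ⟨rfl, by rw [finRotate_last]; rfl⟩
  · refine Or.inr ⟨?_, coe_finRotate_of_ne_last h⟩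
    have := Fin.lt_last_iff_ne_last.mpr h
    exact this

theorem part_rot (π : SetPartition (m + 1)) (x : Fin (m + 1)) :
    (rot π).part (finRotate _ x) = (π.part x).map (finRotate _).toEmbedding := by
  refine Finpartition.part_eq_of_mem _ ?_ ?_
  · rw [rot_parts]
    exact Finset.mem_image_of_mem _ (part_mem_parts π x)
  · exact Finset.mem_map_of_mem _ (mem_own_part π x)

theorem part_rot_eq_iff (π : SetPartition (m + 1)) (x y : Fin (m + 1)) :
    (rot π).part (finRotate _ x) = (rot π).part (finRotate _ y) ↔ π.part x = π.part y := by
  rw [part_rot, part_rot, Finset.map_inj]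

theorem IsNoncrossing.rot {π : SetPartition (m + 1)} (hπ : IsNoncrossing π) :
    IsNoncrossing (rot π) := by
  intro i' j' k' l' hij hjk hkl hik hjl
  obtain ⟨i, rfl⟩ := (finRotate (m + 1)).surjective i'
  obtain ⟨j, rfl⟩ := (finRotate (m + 1)).surjective j'
  obtain ⟨k, rfl⟩ := (finRotate (m + 1)).surjective k'
  obtain ⟨l, rfl⟩ := (finRotate (m + 1)).surjective l'
  rw [part_rot_eq_iff] at hik hjl
  rw [part_rot_eq_iff, part_rot_eq_iff, part_rot_eq_iff]
  have hi := val_finRotate i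
  have hj := val_finRotate j
  have hk := val_finRotate k
  have hl := val_finRotate l
  rw [Fin.lt_def] at hij hjk hkl
  have h1 : j < k := Fin.lt_def.mpr (by omega)
  have h2 : k < l := Fin.lt_def.mpr (by omega)
  rcases hi with ⟨hi, -⟩ | ⟨hi, hi'⟩
  · have h3 : l < i := Fin.lt_def.mpr (by omega)
    obtain ⟨e1, e2, e3⟩ := hπ j k l i h1 h2 h3 hjl hik.symm
    exact ⟨hik.trans e1.symm, e1, e2⟩
  · exact hπ i j k l (Fin.lt_def.mpr (by omega)) h1 h2 hik hjl

theorem sum_rotate (w : Fin (m + 1) → ℤ) (p : Fin (m + 1) → Prop) [DecidablePred p] :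
    ∑ x with p x, w ((finRotate _).symm x) = ∑ x with p (finRotate _ x), w x := by
  rw [Finset.sum_filter, Finset.sum_filter, ← Equiv.sum_comp (finRotate (m + 1))]
  simp only [Equiv.symm_apply_apply]

theorem sum_rotate_part (π : SetPartition (m + 1)) (w : Fin (m + 1) → ℤ) (i : Fin (m + 1)) :
    ∑ x ∈ (rot π).part (finRotate _ i), w ((finRotate _).symm x) = ∑ x ∈ π.part i, w x := by
  rw [part_rot, Finset.sum_map]
  exact Finset.sum_congr rfl fun x _ => by simp

theorem sum_rotate_Icc (w : Fin (m + 1) → ℤ) (i j : Fin (m + 1)) :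
    ∑ x ∈ Finset.Icc i j, w ((finRotate _).symm x) =
      ∑ x with i ≤ finRotate _ x ∧ finRotate _ x ≤ j, w x := by
  rw [← sum_rotate w (fun x => i ≤ x ∧ x ≤ j)]
  refine Finset.sum_congr ?_ fun _ _ => rfl
  ext x; simp

theorem sum_rotate_Ioo (w : Fin (m + 1) → ℤ) (i j : Fin (m + 1)) :
    ∑ x ∈ Finset.Ioo i j, w ((finRotate _).symm x) =
      ∑ x with i < finRotate _ x ∧ finRotate _ x < j, w x := by
  rw [← sum_rotate w (fun x => i < x ∧ x < j)]
  refine Finset.sum_congr ?_ fun _ _ => rfl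
  ext x; simp

theorem sum_add_sum_of_compl (w : Fin (m + 1) → ℤ) {s t : Finset (Fin (m + 1))}
    (h : ∀ x, x ∈ s ↔ x ∉ t) : ∑ x ∈ s, w x + ∑ x ∈ t, w x = ∑ x, w x := by
  have : s = tᶜ := by ext x; rw [Finset.mem_compl]; exact h x
  rw [this, Finset.sum_compl_add_sum]

theorem sum_rotate_Icc_succ (w : Fin (m + 1) → ℤ) {i j : Fin (m + 1)} (hj : j.val < m)
    (hi : i.val < m) : ∑ x ∈ Finset.Icc (finRotate _ i) (finRotate _ j), w ((finRotate _).symm x) =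
      ∑ x ∈ Finset.Icc i j, w x := by
  rw [sum_rotate_Icc]
  refine Finset.sum_congr ?_ fun _ _ => rfl
  ext x
  have h1 := val_finRotate i
  have h2 := val_finRotate j
  have h3 := val_finRotate x
  simp only [Finset.mem_filter, Finset.mem_univ, true_and, Finset.mem_Icc, Fin.le_def]
  omega

theorem sum_rotate_Ioo_succ (w : Fin (m + 1) → ℤ) {i j : Fin (m + 1)} (hj : j.val < m)
    (hi : i.val < m) : ∑ x ∈ Finset.Ioo (finRotate _ i) (finRotate _ j), w ((finRotate _).symm x) =
      ∑ x ∈ Finset.Ioo i j, w x := by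
  rw [sum_rotate_Ioo]
  refine Finset.sum_congr ?_ fun _ _ => rfl
  ext x
  have h1 := val_finRotate i
  have h2 := val_finRotate j
  have h3 := val_finRotate x
  simp only [Finset.mem_filter, Finset.mem_univ, true_and, Finset.mem_Ioo, Fin.lt_def]
  omega

/-- The rotated interval consists of the image of the last label and the images of the labels up to
`j`; what is missed is the open gap before the last label. -/
theorem sum_rotate_Icc_last (w : Fin (m + 1) → ℤ) {i j : Fin (m + 1)} (hj : j.val < m)
    (hi : i.val = m) : ∑ x ∈ Finset.Icc (finRotate _ i) (finRotate _ j), w ((finRotate _).symm x) +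
      ∑ x ∈ Finset.Ioo j i, w x = ∑ x, w x := by
  rw [sum_rotate_Icc]
  refine sum_add_sum_of_compl w fun x => ?_
  have h1 := val_finRotate i
  have h2 := val_finRotate j
  have h3 := val_finRotate x
  simp only [Finset.mem_filter, Finset.mem_univ, true_and, Finset.mem_Ioo, Fin.le_def, Fin.lt_def]
  omega

theorem sum_rotate_Ioo_last (w : Fin (m + 1) → ℤ) {i j : Fin (m + 1)} (hj : j.val < m)
    (hi : i.val = m) : ∑ x ∈ Finset.Ioo (finRotate _ i) (finRotate _ j), w ((finRotate _).symm x) +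
      ∑ x ∈ Finset.Icc j i, w x = ∑ x, w x := by
  rw [sum_rotate_Ioo]
  refine sum_add_sum_of_compl w fun x => ?_
  have h1 := val_finRotate i
  have h2 := val_finRotate j
  have h3 := val_finRotate x
  simp only [Finset.mem_filter, Finset.mem_univ, true_and, Finset.mem_Icc, Fin.le_def, Fin.lt_def]
  omega

theorem isSpan_rot_succ_iff {π : SetPartition (m + 1)} {i j : Fin (m + 1)} (hi : i.val < m)
    (hj : j.val < m) :
    IsSpan (rot π) (finRotate _ i) (finRotate _ j) ↔ IsSpan π i j := by
  have h1 := val_finRotate i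
  have h2 := val_finRotate j
  constructor
  · intro h
    refine ⟨(part_rot_eq_iff π i j).mp h.part_eq, fun k hk => ?_⟩
    have h3 := val_finRotate k
    have h4 := h.le _ ((part_rot_eq_iff π k i).mpr hk)
    rw [Fin.le_def, Fin.le_def] at h4 ⊢
    omega
  · intro h
    refine ⟨(part_rot_eq_iff π i j).mpr h.part_eq, fun k' hk => ?_⟩
    obtain ⟨k, rfl⟩ := (finRotate (m + 1)).surjective k'
    have h3 := val_finRotate k
    have h4 := h.le k ((part_rot_eq_iff π k i).mp hk)
    rw [Fin.le_def, Fin.le_def] at h4 ⊢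
    omega

theorem isConsecutive_rot_succ_iff {π : SetPartition (m + 1)} {i j : Fin (m + 1)} (hi : i.val < m)
    (hj : j.val < m) :
    IsConsecutive (rot π) (finRotate _ i) (finRotate _ j) ↔ IsConsecutive π i j := by
  have h1 := val_finRotate i
  have h2 := val_finRotate j
  constructor
  · intro h
    refine ⟨?_, (part_rot_eq_iff π i j).mp h.part_eq, fun k hk => ?_⟩
    · have h3 := h.lt
      rw [Fin.lt_def] at h3 ⊢
      omega
    have h3 := val_finRotate k
    have h4 := h.gap _ ((part_rot_eq_iff π k i).mpr hk)
    rw [Fin.le_def, Fin.le_def] at h4 ⊢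
    omega
  · intro h
    refine ⟨?_, (part_rot_eq_iff π i j).mpr h.part_eq, fun k' hk => ?_⟩
    · have h3 := h.lt
      rw [Fin.lt_def] at h3 ⊢
      omega
    obtain ⟨k, rfl⟩ := (finRotate (m + 1)).surjective k'
    have h3 := val_finRotate k
    have h4 := h.gap k ((part_rot_eq_iff π k i).mp hk)
    rw [Fin.le_def, Fin.le_def] at h4 ⊢
    omega

/-- The last label becomes the first, so the maximum of its rotated block comes from its predecessor
`j`. -/
theorem isSpan_rot_last_iff {π : SetPartition (m + 1)} {i j : Fin (m + 1)} (hi : i.val = m)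
    (hj : j.val < m) :
    IsSpan (rot π) (finRotate _ i) (finRotate _ j) ↔ IsConsecutive π j i := by
  have h1 := val_finRotate i
  have h2 := val_finRotate j
  constructor
  · intro h
    have e := (part_rot_eq_iff π i j).mp h.part_eq
    refine ⟨Fin.lt_def.mpr (by omega), e.symm, fun k hk => ?_⟩
    have h3 := val_finRotate k
    have h4 := h.le _ ((part_rot_eq_iff π k i).mpr (hk.trans e.symm))
    rw [Fin.le_def, Fin.le_def] at h4 ⊢
    omega
  · intro h
    refine ⟨(part_rot_eq_iff π i j).mpr h.part_eq.symm, fun k' hk => ?_⟩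
    obtain ⟨k, rfl⟩ := (finRotate (m + 1)).surjective k'
    have h3 := val_finRotate k
    have h4 := h.gap k (((part_rot_eq_iff π k i).mp hk).trans h.part_eq.symm)
    rw [Fin.le_def, Fin.le_def] at h4 ⊢
    omega

theorem isConsecutive_rot_last_iff {π : SetPartition (m + 1)} {i j : Fin (m + 1)} (hi : i.val = m)
    (hj : j.val < m) :
    IsConsecutive (rot π) (finRotate _ i) (finRotate _ j) ↔ IsSpan π j i := by
  have h1 := val_finRotate i
  have h2 := val_finRotate j
  constructor
  · intro h
    have e := (part_rot_eq_iff π i j).mp h.part_eq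
    refine ⟨e.symm, fun k hk => ?_⟩
    have h3 := val_finRotate k
    have h4 := h.gap _ ((part_rot_eq_iff π k i).mpr (hk.trans e.symm))
    rw [Fin.le_def, Fin.le_def] at h4 ⊢
    omega
  · intro h
    refine ⟨Fin.lt_def.mpr (by omega), (part_rot_eq_iff π i j).mpr h.part_eq.symm, fun k' hk => ?_⟩
    obtain ⟨k, rfl⟩ := (finRotate (m + 1)).surjective k'
    have h3 := val_finRotate k
    have h4 := h.le k (((part_rot_eq_iff π k i).mp hk).trans h.part_eq.symm)
    rw [Fin.le_def, Fin.le_def] at h4 ⊢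
    omega

/-- Away from the last label both conditions are just shifted. At the last label they swap by
passing to complements, using total weight `a` and the ground set size `b - 1`. -/
theorem IsWeighting.rot {a b : ℕ} (hb : b = m + 2) {π : SetPartition (m + 1)}
    {w : Fin (m + 1) → ℤ} (hw : IsWeighting a b π w) (hg : FillsGaps a b π w) :
    IsWeighting a b (rot π) (fun x => w ((finRotate _).symm x)) ∧
      FillsGaps a b (RationalCatalan.rot π) (fun x => w ((finRotate _).symm x)) := by
  have htot := hw.total
  have hbz : (b : ℤ) = m + 2 := by exact_mod_cast hb
  refine ⟨⟨fun i' => ?_, ?_, fun i' j' h => ?_⟩, fun i' j' h => ?_⟩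
  · obtain ⟨i, rfl⟩ := (finRotate (m + 1)).surjective i'
    rw [sum_rotate_part]
    exact hw.pos i
  · rw [← htot]
    exact Equiv.sum_comp (finRotate (m + 1)).symm w
  · obtain ⟨i, rfl⟩ := (finRotate (m + 1)).surjective i'
    obtain ⟨j, rfl⟩ := (finRotate (m + 1)).surjective j'
    have hij := Fin.le_def.mp h.left_le_right
    rcases val_finRotate i with ⟨hi, hi'⟩ | ⟨hi, hi'⟩ <;>
      rcases val_finRotate j with ⟨hj, hj'⟩ | ⟨hj, hj'⟩
    -- Here the last label is a singleton block, which becomes the singleton block of the first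
    -- label.
    · obtain rfl : i = j := Fin.ext (by omega)
      have hs : IsSpan π i i := ⟨rfl, fun k hk => by
        have h1 := h.le _ ((part_rot_eq_iff π k i).mpr hk)
        have h2 : k = i := (finRotate _).injective (le_antisymm h1.2 h1.1)
        exact ⟨h2.ge, h2.le⟩⟩
      have h1 := hw.span i i hs
      simpa using h1
    · have h1 := hg j i ((isSpan_rot_last_iff hi hj).mp h)
      have h2 := sum_rotate_Icc_last w hj hi
      rw [htot] at h2
      rw [eq_sub_of_add_eq h2, hi', hj']
      rw [hi] at h1
      push_cast
      constructor <;> nlinarith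
    · omega
    · have h1 := hw.span i j ((isSpan_rot_succ_iff hi hj).mp h)
      rw [sum_rotate_Icc_succ w hj hi, hi', hj']
      push_cast
      constructor <;> linarith
  · obtain ⟨i, rfl⟩ := (finRotate (m + 1)).surjective i'
    obtain ⟨j, rfl⟩ := (finRotate (m + 1)).surjective j'
    have hij := Fin.lt_def.mp h.lt
    rcases val_finRotate i with ⟨hi, hi'⟩ | ⟨hi, hi'⟩ <;>
      rcases val_finRotate j with ⟨hj, hj'⟩ | ⟨hj, hj'⟩
    · omega
    · have h1 := hw.span j i ((isConsecutive_rot_last_iff hi hj).mp h)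
      have h2 := sum_rotate_Ioo_last w hj hi
      rw [htot] at h2
      rw [eq_sub_of_add_eq h2, hi', hj']
      rw [hi] at h1
      push_cast
      constructor <;> nlinarith
    · omega
    · have h1 := hg i j ((isConsecutive_rot_succ_iff hi hj).mp h)
      rw [sum_rotate_Ioo_succ w hj hi, hi', hj']
      push_cast
      constructor <;> linarith

theorem hasValidRanking_of_mem_rotOrbit {a b : ℕ} (hb : b = m + 2) {π : SetPartition (m + 1)}
    (hπ : IsNoncrossing π) {w : Fin (m + 1) → ℤ} (hw : IsWeighting a b π w)
    (hg : FillsGaps a b π w) {ρ : SetPartition (m + 1)} (hρ : ρ ∈ rotOrbit π) :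
    HasValidRanking a b ρ := by
  obtain ⟨k, rfl⟩ := hρ
  induction k generalizing π w with
  | zero => exact (hasValidRanking_iff (by omega) hπ).mpr ⟨w, hw⟩
  | succ k ih =>
    rw [Function.iterate_succ_apply]
    exact ih hπ.rot (hw.rot hb hg).1 (hw.rot hb hg).2

/-- If a partition and its rotation both have valid rankings, then rotation preserves ranks. -/
theorem IsWeighting.rot_of_isWeighting {a b : ℕ} (hb : 0 < b) {π : SetPartition (m + 1)}
    (hπ : IsNoncrossing π) {w v : Fin (m + 1) → ℤ} (hw : IsWeighting a b π w)
    (hv : IsWeighting a b (RationalCatalan.rot π) v) :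
    IsWeighting a b (RationalCatalan.rot π) (fun x => w ((finRotate _).symm x)) := by
  set u : Fin (m + 1) → ℤ := fun x => v (finRotate _ x) with hu
  have huv : (fun x => u ((finRotate _).symm x)) = v := by
    funext x; simp [hu]
  -- Blocks avoiding the last label keep their spans up to a shift, so both weightings agree on
  -- them.
  have hsmall : ∀ i j, IsSpan π i j → j.val < m → ∑ x ∈ π.part i, (u x - w x) = 0 := by
    refine fun i j h hj => sum_part_eq_zero hπ m (fun i j h hj => ?_) h hj
    have hi : i.val < m := lt_of_le_of_lt (Fin.le_def.mp h.left_le_right) hj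
    have h1 := val_finRotate i
    have h2 := val_finRotate j
    have h3 := hv.span _ _ ((isSpan_rot_succ_iff hi hj).mpr h)
    rw [← huv, sum_rotate_Icc_succ u hj hi] at h3
    have h4 := (eq_rankSum_iff hb h _).mpr (hw.span i j h)
    have h5 : ∑ x ∈ Finset.Icc i j, u x = rankSum a b (π.part i) := by
      refine (eq_rankSum_iff hb h _).mpr ?_
      have e1 : ((finRotate (m + 1) i).val : ℤ) = i.val + 1 := by omega
      have e2 : ((finRotate (m + 1) j).val : ℤ) = j.val + 1 := by omega
      rw [e1, e2] at h3
      constructor <;> linarith [h3.1, h3.2]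
    rw [Finset.sum_sub_distrib, h4, h5, sub_self]
  have hu_tot : ∑ x, u x = a := by
    rw [← hv.total]
    exact Equiv.sum_comp (finRotate (m + 1)) v
  -- The block of the last label is the only one left, and the total `a` fixes its sum.
  have hall : ∀ k, ∑ x ∈ π.part k, (u x - w x) = 0 := by
    intro k
    obtain ⟨i, j, h, he⟩ := exists_isSpan π k
    rw [← he]
    rcases lt_or_ge j.val m with hj | hj
    · exact hsmall i j h hj
    have h1 : ∑ x, (u x - w x) = 0 := by
      rw [Finset.sum_sub_distrib, hu_tot, hw.total, sub_self]
    rw [sum_eq_sum_parts π _ (fun _ _ _ _ => Finset.mem_univ _)] at h1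
    rw [← h1]
    symm
    refine Finset.sum_eq_single_of_mem _ (Finset.mem_filter.mpr
      ⟨part_mem_parts π i, Finset.subset_univ _⟩) fun B hB hne => ?_
    obtain ⟨l, rfl⟩ := exists_part_eq (Finset.mem_filter.mp hB).1
    obtain ⟨i', j', h', he'⟩ := exists_isSpan π l
    rw [← he'] at hne ⊢
    refine hsmall i' j' h' (lt_of_le_of_ne (by omega) fun hj' => hne ?_)
    have : j' = j := Fin.ext (by omega)
    rw [h'.part_eq, h.part_eq, this]
  refine ⟨fun i' => ?_, ?_, fun i' j' h => ?_⟩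
  · obtain ⟨i, rfl⟩ := (finRotate (m + 1)).surjective i'
    rw [sum_rotate_part]
    exact hw.pos i
  · rw [← hw.total]
    exact Equiv.sum_comp (finRotate (m + 1)).symm w
  · have h1 := hv.span i' j' h
    suffices e : ∑ x ∈ Finset.Icc i' j', w ((finRotate _).symm x) =
        ∑ x ∈ Finset.Icc i' j', v x by
      rw [e]; exact h1
    have hcl := fun x y => h.mem_Icc_of_part_eq hπ.rot (x := x) (y := y)
    rw [sum_eq_sum_parts _ _ hcl, sum_eq_sum_parts _ _ hcl]
    refine Finset.sum_congr rfl fun B hB => ?_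
    obtain ⟨k', rfl⟩ := exists_part_eq (Finset.mem_filter.mp hB).1
    obtain ⟨k, rfl⟩ := (finRotate (m + 1)).surjective k'
    rw [sum_rotate_part, ← huv, sum_rotate_part π u]
    have h2 := hall k
    rw [Finset.sum_sub_distrib] at h2
    linarith

/-- Rotate until the right end of the gap is the last label; one further rotation makes the gap the
complement of a span, where the valid ranking applies. -/
theorem fillsGaps_of_rotOrbit {a b : ℕ} (hb : b = m + 2) {π : SetPartition (m + 1)}
    (hπ : IsNoncrossing π) (hv : ∀ ρ ∈ rotOrbit π, HasValidRanking a b ρ)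
    {w : Fin (m + 1) → ℤ} (hw : IsWeighting a b π w) : FillsGaps a b π w := by
  intro i j h
  induction hd : m - j.val generalizing π w i j with
  | zero =>
    have hrot : HasValidRanking a b (rot π) := hv _ ⟨1, rfl⟩
    obtain ⟨v, hv'⟩ := (hasValidRanking_iff (by omega) hπ.rot).mp hrot
    have h0 := hw.rot_of_isWeighting (by omega) hπ hv'
    have hij := Fin.lt_def.mp h.lt
    have hj : j.val = m := by omega
    have hi : i.val < m := by omega
    have h1 := h0.span _ _ ((isSpan_rot_last_iff hj hi).mpr h)
    have h2 := sum_rotate_Icc_last w hi hj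
    rw [hw.total] at h2
    have e1 := val_finRotate i
    have e2 := val_finRotate j
    have e1' : ((finRotate (m + 1) i).val : ℤ) = i.val + 1 := by omega
    have e2' : ((finRotate (m + 1) j).val : ℤ) = 0 := by omega
    rw [eq_sub_of_add_eq h2, e1', e2'] at h1
    have hbz : (b : ℤ) = m + 2 := by exact_mod_cast hb
    rw [hj]
    constructor <;> nlinarith [h1.1, h1.2]
  | succ d ih =>
    have hrot : HasValidRanking a b (rot π) := hv _ ⟨1, rfl⟩
    obtain ⟨v, hv'⟩ := (hasValidRanking_iff (by omega) hπ.rot).mp hrot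
    have h0 := hw.rot_of_isWeighting (by omega) hπ hv'
    have hij := Fin.lt_def.mp h.lt
    have hj : j.val < m := by omega
    have hi : i.val < m := by omega
    have e1 := val_finRotate i
    have e2 := val_finRotate j
    have h1 := ih hπ.rot (fun ρ ⟨k, hk⟩ => hv ρ ⟨k + 1, by rw [hk, Function.iterate_succ_apply]⟩)
      h0 _ _ ((isConsecutive_rot_succ_iff hi hj).mpr h) (by omega)
    rw [sum_rotate_Ioo_succ w hj hi] at h1
    have e1' : ((finRotate (m + 1) i).val : ℤ) = i.val + 1 := by omega
    have e2' : ((finRotate (m + 1) j).val : ℤ) = j.val + 1 := by omega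
    rw [e1', e2'] at h1
    constructor <;> linarith [h1.1, h1.2]

end Rotation

/-! ### Partial sums of weights. -/

section PartialSums

variable {n : ℕ}

/-- The sum of the weights of the first `x` labels. -/
def partialSum (w : Fin n → ℤ) (x : ℕ) : ℤ := ∑ y with y.val < x, w y

theorem partialSum_zero (w : Fin n → ℤ) : partialSum w 0 = 0 := by simp [partialSum]

theorem partialSum_of_le (w : Fin n → ℤ) {x : ℕ} (hx : n ≤ x) : partialSum w x = ∑ y, w y := by
  rw [partialSum, Finset.filter_true_of_mem]
  intro y _
  omega

theorem partialSum_add_sum (w : Fin n → ℤ) {u v : ℕ} {s : Finset (Fin n)} (huv : u ≤ v)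
    (hs : ∀ x, x ∈ s ↔ u ≤ x.val ∧ x.val < v) :
    partialSum w u + ∑ x ∈ s, w x = partialSum w v := by
  rw [partialSum, partialSum, ← Finset.sum_union]
  · refine Finset.sum_congr ?_ fun _ _ => rfl
    ext x
    simp only [Finset.mem_union, Finset.mem_filter, Finset.mem_univ, true_and, hs]
    omega
  · rw [Finset.disjoint_left]
    intro x hx hx'
    have h1 := (Finset.mem_filter.mp hx).2
    have h2 := (hs x).mp hx'
    omega

theorem partialSum_succ (w : Fin n → ℤ) (x : Fin n) :
    partialSum w (x.val + 1) = partialSum w x + w x := by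
  rw [← partialSum_add_sum w (Nat.le_succ x.val) (s := {x}) fun y => by
    rw [Finset.mem_singleton, Fin.ext_iff]; omega, Finset.sum_singleton]

theorem sum_Icc_eq (w : Fin n → ℤ) {i j : Fin n} (h : i ≤ j) :
    ∑ x ∈ Finset.Icc i j, w x = partialSum w (j.val + 1) - partialSum w i := by
  rw [← partialSum_add_sum w (u := i) (v := j.val + 1) (s := Finset.Icc i j)]
  · ring
  · have := Fin.le_def.mp h; omega
  · intro x; rw [Finset.mem_Icc, Fin.le_def, Fin.le_def]; omega

theorem sum_Ioo_eq (w : Fin n → ℤ) {i j : Fin n} (h : i < j) :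
    ∑ x ∈ Finset.Ioo i j, w x = partialSum w j - partialSum w (i.val + 1) := by
  rw [← partialSum_add_sum w (u := i.val + 1) (v := j.val) (s := Finset.Ioo i j)]
  · ring
  · have := Fin.lt_def.mp h; omega
  · intro x; rw [Finset.mem_Ioo, Fin.lt_def, Fin.lt_def]; omega

theorem partialSum_eq_of_succ (w : Fin n → ℤ) (f : ℕ → ℤ) (h0 : f 0 = 0)
    (hf : ∀ x : Fin n, w x = f (x.val + 1) - f x) {x : ℕ} (hx : x ≤ n) :
    partialSum w x = f x := by
  induction x with
  | zero => rw [partialSum_zero, h0]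
  | succ x ih =>
    rw [partialSum_succ w ⟨x, hx⟩, hf, ih (by omega)]
    ring

end PartialSums

/-! ### North run lengths as weights for the partition of a path. -/

namespace DyckPath

variable {a b : ℕ}

theorem slack_succ (D : DyckPath a b) (x : ℕ) :
    D.slack (x + 1) = D.slack x + b * ((D.height (x + 1) : ℤ) - D.height x) - a := by
  unfold slack; push_cast; ring

theorem slack_le_slack_succ_add (D : DyckPath a b) (x : ℕ) : D.slack x ≤ D.slack (x + 1) + a := by
  have h : (D.height x : ℤ) ≤ D.height (x + 1) := by exact_mod_cast D.height_mono (Nat.le_succ x)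
  rw [slack_succ]
  nlinarith

theorem slack_lt_slack_succ (D : DyckPath a b) (hab : a < b) {x : ℕ}
    (h : D.height x < D.height (x + 1)) : D.slack x < D.slack (x + 1) := by
  have h' : (D.height x : ℤ) + 1 ≤ D.height (x + 1) := by exact_mod_cast h
  have hab' : (a : ℤ) < b := by exact_mod_cast hab
  rw [slack_succ]
  nlinarith

theorem height_lt_of_slack_le (D : DyckPath a b) (ha : 0 < a) {x : ℕ}
    (h : D.slack x ≤ D.slack (x + 1)) : D.height x < D.height (x + 1) := by
  by_contra hn
  have h' : D.height (x + 1) = D.height x :=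
    le_antisymm (not_lt.mp hn) (D.height_mono (Nat.le_succ x))
  rw [slack_succ, h', sub_self, mul_zero] at h
  omega

theorem slack_pos (D : DyckPath a b) (hcop : Nat.Coprime a b) {x : ℕ} (h0 : 1 ≤ x) (hx : x < b) :
    0 < D.slack x := by
  refine lt_of_le_of_ne (D.slack_nonneg hx.le) ?_
  rw [← D.slack_zero]
  exact D.slack_ne hcop h0 (by omega)

/-- A north run starts a new block. -/
theorem le_of_part_eq_of_height_lt (D : DyckPath a b) (ha : 0 < a) (hab : a < b)
    (hcop : Nat.Coprime a b) {i k : Fin (b - 1)} (hi : D.height i < D.height (i + 1))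
    (hk : D.partition.part k = D.partition.part i) : i ≤ k := by
  by_contra hlt
  rw [Fin.le_def] at hlt
  obtain ⟨m, h1, h2, h3, h4⟩ := D.exists_first_slack_lt (p := i) (c := D.slack i) (by omega)
    (by rw [D.slack_last (by omega)]; exact D.slack_pos hcop (by omega) (by omega))
  -- A north step outweighs an east step because `a < b`, so the slack rises after `i` and the
  -- pocket contains `i` itself.
  have hm : i.val < m := by
    refine lt_of_le_of_ne h1 fun e => ?_
    have := D.slack_lt_slack_succ hab hi
    rw [← e] at h3
    omega
  have hq : (i.val, m) ∈ D.lasers := (D.mem_lasers_iff ha hcop _).mpr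
    ⟨by simp only; omega, hi, h1, h2, h3, fun t ht ht' => ht.eq_or_lt.elim
      (fun e => by rw [← e]) fun e => h4 t e ht'⟩
  have h5 := (D.partition_part_eq_iff k i).mp hk _ hq
  simp only at h5
  omega

/-- The predecessor in its block of a label that does not end a north run. -/
theorem exists_predecessor (D : DyckPath a b) (ha : 0 < a) (hcop : Nat.Coprime a b)
    {i : Fin (b - 1)} (hi : D.height (i + 1) = D.height i) :
    ∃ q : Fin (b - 1), D.partition.part q = D.partition.part i ∧ q < i ∧
      (∀ k, D.partition.part k = D.partition.part i → k ≤ q ∨ i ≤ k) ∧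
        D.slack (i + 1) < D.slack (q + 1) ∧ D.slack (q + 1) ≤ D.slack (i + 1) + a := by
  classical
  have hi1 : D.slack (i + 1) = D.slack i - a := by
    rw [D.slack_succ, hi, sub_self, mul_zero, add_zero]
  -- The least such `q`, if below `i`, is the leftmost valley whose laser ends in the east step
  -- leaving column `i`; the label just before that pocket is the predecessor of `i`. The choice `q
  -- = i` covers the case without such a laser.
  have hex : ∃ q, D.slack (i + 1) < D.slack q ∧ q ≤ i.val ∧
      ∀ t, q ≤ t → t ≤ i.val → D.slack q ≤ D.slack t :=
    ⟨i, by omega, le_rfl, fun t h h' => by rw [le_antisymm h h']⟩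
  obtain ⟨h1, h2, h3⟩ := Nat.find_spec hex
  have hmin : ∀ p, p < Nat.find hex → D.slack (i + 1) < D.slack p → p ≤ i.val →
      ¬ ∀ t, p ≤ t → t ≤ i.val → D.slack p ≤ D.slack t :=
    fun p hp h4 h5 h6 => Nat.find_min hex hp ⟨h4, h5, h6⟩
  generalize Nat.find hex = q at h1 h2 h3 hmin
  have hq0 : q ≠ 0 := by
    rintro rfl
    rw [D.slack_zero] at h1
    have := D.slack_nonneg (x := i + 1) (by omega)
    omega
  obtain ⟨q, rfl⟩ := Nat.exists_eq_succ_of_ne_zero hq0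
  rw [Nat.succ_eq_add_one] at h1 h2 h3 hmin
  refine ⟨⟨q, by omega⟩, ?_, Fin.lt_def.mpr h2, fun k hk => ?_, h1, ?_⟩
  · rw [D.partition_part_eq_iff]
    rintro ⟨p, m⟩ hpm
    obtain ⟨g1, g2, g3, g4, g5, g6⟩ := (D.mem_lasers_iff ha hcop _).mp hpm
    simp only at g1 g2 g3 g4 g5 g6 ⊢
    constructor
    · rintro ⟨h5, h6⟩
      refine ⟨by omega, ?_⟩
      by_contra h7
      have h8 := g6 (q + 1) (by omega) (by omega)
      rcases (not_lt.mp h7).eq_or_lt with rfl | h9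
      · exact hmin p (by omega) g5 (by omega) g6
      · have := h3 (m + 1) (by omega) h9
        omega
    · rintro ⟨h5, h6⟩
      refine ⟨?_, by omega⟩
      by_contra h7
      have h8 := g6 (i + 1) (by omega) (by omega)
      have h9 := h3 p (by omega) h5
      omega
  · by_contra hn
    rw [not_or, Fin.le_def, Fin.le_def] at hn
    simp only at hn
    have hq : (q + 1, i.val) ∈ D.lasers := (D.mem_lasers_iff ha hcop _).mpr
      ⟨by simp only; omega, D.height_lt_of_slack_le ha (h3 _ (Nat.le_succ _) (by omega)), h2,
        by simp only; omega, h1, h3⟩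
    have h5 := (D.partition_part_eq_iff k i).mp hk _ hq
    simp only at h5
    omega
  · have := h3 i h2 le_rfl
    simp only
    omega

/-- The last label of the block that starts with a given north run. -/
theorem exists_block_max (D : DyckPath a b) (ha : 0 < a) (hab : a < b) (hcop : Nat.Coprime a b)
    {i : Fin (b - 1)} (hi : D.height i < D.height (i + 1)) :
    ∃ j : Fin (b - 1), D.partition.part j = D.partition.part i ∧
      (∀ k, D.partition.part k = D.partition.part i → k ≤ j) ∧
        D.slack i < D.slack (j + 1) ∧ D.slack (j + 1) ≤ D.slack i + a := by
  classical
  -- The level `slack i + 1` also covers `i = 0`, where no laser is fired and the slack returns to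
  -- zero only at `b`.
  obtain ⟨m, h1, h2, h3, h4⟩ := D.exists_first_slack_lt (p := i) (c := D.slack i + 1) (by omega)
    (by rw [D.slack_last (by omega)]; have := D.slack_nonneg (x := i) (by omega); omega)
  have him : i.val < m := by
    refine lt_of_le_of_ne h1 fun e => ?_
    have := D.slack_lt_slack_succ hab hi
    rw [← e] at h3
    omega
  have hm := h4 m him le_rfl
  have hex : ∃ q, D.slack (m + 1) < D.slack q ∧ i.val < q ∧ q ≤ m ∧
      ∀ t, q ≤ t → t ≤ m → D.slack q ≤ D.slack t :=
    ⟨m, by omega, him, le_rfl, fun t h h' => by rw [le_antisymm h h']⟩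
  obtain ⟨h5, h6, h7, h8⟩ := Nat.find_spec hex
  have hmin : ∀ p, p < Nat.find hex → D.slack (m + 1) < D.slack p → i.val < p → p ≤ m →
      ¬ ∀ t, p ≤ t → t ≤ m → D.slack p ≤ D.slack t :=
    fun p hp g1 g2 g3 g4 => Nat.find_min hex hp ⟨g1, g2, g3, g4⟩
  generalize Nat.find hex = q at h5 h6 h7 h8 hmin
  obtain ⟨q, rfl⟩ : ∃ z, q = z + 1 := ⟨q - 1, by omega⟩
  refine ⟨⟨q, by omega⟩, ?_, fun k hk => ?_, ?_, ?_⟩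
  · rw [D.partition_part_eq_iff]
    rintro ⟨p, m'⟩ hpm
    obtain ⟨g1, g2, g3, g4, g5, g6⟩ := (D.mem_lasers_iff ha hcop _).mp hpm
    simp only at g1 g2 g3 g4 g5 g6 ⊢
    constructor
    · rintro ⟨h9, h10⟩
      refine ⟨?_, by omega⟩
      by_contra h11
      rcases lt_trichotomy m' m with h12 | rfl | h12
      · have e1 := g6 (q + 1) (by omega) (by omega)
        have e2 := h8 (m' + 1) (by omega) (by omega)
        omega
      · exact hmin p (by omega) g5 (by omega) (by omega) g6
      · have e1 := g6 (m + 1) (by omega) (by omega)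
        have e2 := h4 p (by omega) (by omega)
        omega
    · rintro ⟨h9, h10⟩
      refine ⟨by omega, ?_⟩
      by_contra h11
      have e1 := g6 i h9 (by omega)
      have e2 := h4 (m' + 1) (by omega) (by omega)
      omega
  · by_contra hn
    rw [Fin.le_def] at hn
    simp only at hn
    rcases lt_or_ge k.val m with hkm | hkm
    · have hq : (q + 1, m) ∈ D.lasers := (D.mem_lasers_iff ha hcop _).mpr
        ⟨by simp only; omega, D.height_lt_of_slack_le ha (h8 _ (Nat.le_succ _) (by omega)), h7,
          h2, h5, h8⟩
      have h9 := (D.partition_part_eq_iff k i).mp hk _ hq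
      simp only at h9
      omega
    · have hne := D.slack_ne hcop (x := i) (y := m + 1) (by omega)
      rcases Nat.eq_zero_or_pos i.val with h0 | h0
      · rw [h0, D.slack_zero] at hne h3
        have := D.slack_nonneg (x := m + 1) (by omega)
        omega
      · have hne' := hne (by omega)
        have hq : (i.val, m) ∈ D.lasers := (D.mem_lasers_iff ha hcop _).mpr
          ⟨h0, hi, h1, h2, by simp only; omega, fun t ht ht' => ht.eq_or_lt.elim
            (fun e => by rw [← e]) fun e => by have := h4 t e ht'; simp only; omega⟩
        have h9 := (D.partition_part_eq_iff k i).mp hk _ hq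
        simp only at h9
        omega
  · have := h4 (q + 1) h6 h7
    simp only
    omega
  · have e1 := h8 m h7 le_rfl
    have e2 := D.slack_le_slack_succ_add m
    simp only
    omega

/-- The lengths of the north runs are weights with a valid ranking for `π(D)`. -/
theorem exists_isWeighting_partition (D : DyckPath a b) (ha : 0 < a) (hab : a < b)
    (hcop : Nat.Coprime a b) :
    ∃ w, IsWeighting a b D.partition w ∧ FillsGaps a b D.partition w := by
  have hab' : (a : ℤ) < b := by exact_mod_cast hab
  set w : Fin (b - 1) → ℤ := fun x => (D.height (x + 1) : ℤ) - D.height x with hw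
  have hP : ∀ x ≤ b - 1, partialSum w x = D.height x := fun x hx =>
    partialSum_eq_of_succ w (fun x => (D.height x : ℤ)) (by simp [D.height_zero])
      (fun x => rfl) hx
  have hw0 : ∀ x, 0 ≤ w x := fun x => by
    have : D.height x ≤ D.height (x + 1) := D.height_mono (Nat.le_succ x.val)
    simp only [hw]
    omega
  have hleft : ∀ i j, IsSpan D.partition i j → D.height i < D.height (i + 1) := by
    intro i j h
    by_contra hn
    obtain ⟨q, h1, h2, -⟩ := D.exists_predecessor ha hcop (i := i)
      (le_antisymm (not_lt.mp hn) (D.height_mono (Nat.le_succ _)))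
    exact absurd (h.le q h1).1 (not_le.mpr h2)
  refine ⟨w, ⟨fun k => ?_, ?_, fun i j h => ?_⟩, fun i j h => ?_⟩
  · obtain ⟨i, j, h, he⟩ := exists_isSpan D.partition k
    have h1 := hleft i j h
    rw [← he]
    refine lt_of_lt_of_le ?_ (Finset.single_le_sum (fun x _ => hw0 x) (mem_own_part _ i))
    simp only [hw]
    omega
  · rw [← partialSum_of_le w le_rfl, hP _ le_rfl]
    -- As `a < b`, staying above the line at `b - 1` already forces height `a`, so no north step is
    -- missed by the labels.
    have h1 := D.slack_nonneg (x := b - 1) (by omega)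
    have h2 := D.height_le_a (b - 1)
    unfold slack at h1
    rw [Nat.cast_sub (by omega)] at h1
    push_cast at h1
    have h3 : (D.height (b - 1) : ℤ) ≤ a := by exact_mod_cast h2
    refine le_antisymm h3 ?_
    by_contra hn
    nlinarith
  · obtain ⟨j', h1, h2, h3, h4⟩ := D.exists_block_max ha hab hcop (hleft i j h)
    obtain rfl : j' = j := le_antisymm (h.le j' h1).2 (h2 j h.part_eq.symm)
    rw [sum_Icc_eq w h.left_le_right, hP _ (by omega), hP _ (by omega)]
    unfold slack at h3 h4
    push_cast at h3 h4
    constructor <;> linarith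
  · have h0 : D.height (j + 1) = D.height j := by
      by_contra hn
      have h1 := D.le_of_part_eq_of_height_lt ha hab hcop (i := j) (k := i)
        (lt_of_le_of_ne (D.height_mono (Nat.le_succ _)) (Ne.symm hn)) h.part_eq
      exact absurd h.lt (not_lt.mpr h1)
    obtain ⟨q, h1, h2, h3, h4, h5⟩ := D.exists_predecessor ha hcop h0
    have hqi : q = i := by
      refine le_antisymm ?_ ?_
      · exact (h.gap q (h1.trans h.part_eq.symm)).resolve_right (not_le.mpr h2)
      · exact (h3 i h.part_eq).resolve_right (not_le.mpr h.lt)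
    subst hqi
    rw [sum_Ioo_eq w h.lt, hP _ (by omega), hP _ (by omega)]
    unfold slack at h4 h5
    rw [h0] at h4 h5
    push_cast at h4 h5
    constructor <;> linarith

end DyckPath

/-! ### From weights back to a path. -/

section Reconstruction

variable {n : ℕ}

theorem exists_straddling (π : SetPartition n) {x y : Fin n} {c : ℕ} (hxy : π.part x = π.part y)
    (hx : x.val < c) (hy : c ≤ y.val) :
    ∃ z z', IsConsecutive π z z' ∧ π.part z = π.part x ∧ x ≤ z ∧ z.val < c ∧ c ≤ z'.val ∧
      z' ≤ y := by
  set s := (π.part x).filter (fun z => z.val < c)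
  set t := (π.part x).filter (fun z => c ≤ z.val)
  have hxs : x ∈ s := Finset.mem_filter.mpr ⟨mem_own_part π x, hx⟩
  have hyt : y ∈ t := Finset.mem_filter.mpr ⟨(mem_part_iff π).mpr hxy.symm, hy⟩
  obtain ⟨h1, h2⟩ := Finset.mem_filter.mp (s.max'_mem ⟨x, hxs⟩)
  obtain ⟨h3, h4⟩ := Finset.mem_filter.mp (t.min'_mem ⟨y, hyt⟩)
  rw [mem_part_iff] at h1 h3
  refine ⟨_, _, ⟨Fin.lt_def.mpr (lt_of_lt_of_le h2 h4), h1.trans h3.symm, fun k hk => ?_⟩, h1,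
    s.le_max' x hxs, h2, h4, t.min'_le y hyt⟩
  have hk' := (mem_part_iff π).mpr (hk.trans h1)
  rcases lt_or_ge k.val c with h | h
  · exact Or.inl (s.le_max' k (Finset.mem_filter.mpr ⟨hk', h⟩))
  · exact Or.inr (t.min'_le k (Finset.mem_filter.mpr ⟨hk', h⟩))

/-- The slack at `x` of the lattice path whose north runs are given by the weights `w`. -/
def weightSlack (a b : ℕ) (w : Fin n → ℤ) (x : ℕ) : ℤ := (b : ℤ) * partialSum w x - a * x

/-- The weights are supported on the smallest elements of the blocks. -/
def IsNormalized (π : SetPartition n) (w : Fin n → ℤ) : Prop :=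
  ∀ x y, π.part y = π.part x → y < x → w x = 0

variable {a b : ℕ} {π : SetPartition n} {w : Fin n → ℤ}

/-- Spans and gaps are unions of blocks, so moving the weight of each block to its minimum changes
none of the sums involved. -/
theorem IsWeighting.exists_isNormalized (hπ : IsNoncrossing π) (hw : IsWeighting a b π w)
    (hg : FillsGaps a b π w) :
    ∃ v, IsWeighting a b π v ∧ FillsGaps a b π v ∧ IsNormalized π v := by
  obtain ⟨v, hv, hv0⟩ := exists_weight π fun B => ∑ x ∈ B.1, w x
  have key : ∀ A : Finset (Fin n), (∀ x y, π.part x = π.part y → x ∈ A → y ∈ A) →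
      ∑ x ∈ A, v x = ∑ x ∈ A, w x := fun A hA => by
    rw [sum_eq_sum_parts π v hA, sum_eq_sum_parts π w hA]
    exact Finset.sum_congr rfl fun B hB => (hv ⟨B, (Finset.mem_filter.mp hB).1⟩).symm
  refine ⟨v, ⟨fun i => ?_, ?_, fun i j h => ?_⟩, fun i j h => ?_, hv0⟩
  · rw [← hv ⟨_, part_mem_parts π i⟩]
    exact hw.pos i
  · rw [key _ fun _ _ _ _ => Finset.mem_univ _, hw.total]
  · rw [key _ fun _ _ => h.mem_Icc_of_part_eq hπ]
    exact hw.span i j h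
  · rw [key _ fun _ _ => h.mem_Ioo_of_part_eq hπ]
    exact hg i j h

theorem IsNormalized.pos_of_isSpan (h0 : IsNormalized π w) (hw : IsWeighting a b π w)
    {i j : Fin n} (h : IsSpan π i j) : 0 < w i := by
  have h1 := hw.pos i
  rwa [Finset.sum_eq_single_of_mem i (mem_own_part π i)] at h1
  intro x hx hne
  have hx' := (mem_part_iff π).mp hx
  exact h0 x i hx'.symm (lt_of_le_of_ne (h.le x hx').1 hne.symm)

theorem IsNormalized.nonneg (h0 : IsNormalized π w) (hw : IsWeighting a b π w) (x : Fin n) :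
    0 ≤ w x := by
  obtain ⟨i, j, h, he⟩ := exists_isSpan π x
  rcases (h.le x he.symm).1.eq_or_lt with rfl | hlt
  · exact (h0.pos_of_isSpan hw h).le
  · rw [h0 x i he hlt]

theorem IsWeighting.weightSlack_lt (hw : IsWeighting a b π w)
    (hcop : Nat.Coprime a b) (hn : n < b) {i j : Fin n} (h : IsSpan π i j) :
    weightSlack a b w i < weightSlack a b w (j + 1) := by
  have h1 := (hw.span i j h).1
  have h2 := Fin.le_def.mp h.left_le_right
  refine lt_of_le_of_ne ?_ fun e => ?_
  · rw [sum_Icc_eq w h.left_le_right] at h1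
    unfold weightSlack
    push_cast
    linarith
  · unfold weightSlack at e
    have h3 : (b : ℤ) ∣ a * ((j.val + 1 - i.val : ℕ) : ℤ) := by
      refine ⟨partialSum w (j + 1) - partialSum w i, ?_⟩
      rw [Nat.cast_sub (by omega)]
      push_cast at e ⊢
      linarith
    have h4 : b ∣ a * (j.val + 1 - i.val) := by exact_mod_cast h3
    have h5 := Nat.le_of_dvd (by omega) (hcop.symm.dvd_of_dvd_mul_left h4)
    omega

/-- As `j` is not a minimum it carries no weight, so the gap sum is also the rise from `i + 1` to `j
+ 1`. Coprimality excludes equality. -/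
theorem FillsGaps.weightSlack_lt (hg : FillsGaps a b π w) (h0 : IsNormalized π w)
    (hcop : Nat.Coprime a b) (hn : n < b) {i j : Fin n} (h : IsConsecutive π i j) :
    weightSlack a b w (j + 1) < weightSlack a b w (i + 1) := by
  have h1 := (hg i j h).1
  have h2 := Fin.lt_def.mp h.lt
  have h3 := h0 j i h.part_eq h.lt
  have h4 := partialSum_succ w j
  rw [h3, add_zero] at h4
  rw [sum_Ioo_eq w h.lt] at h1
  unfold weightSlack
  rw [h4]
  refine lt_of_le_of_ne ?_ fun e => ?_
  · push_cast
    linarith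
  · have h3 : (b : ℤ) ∣ a * ((j.val - i.val : ℕ) : ℤ) := by
      refine ⟨partialSum w j - partialSum w (i + 1), ?_⟩
      rw [Nat.cast_sub (by omega)]
      push_cast at e ⊢
      linarith
    have h4 : b ∣ a * (j.val - i.val) := by exact_mod_cast h3
    have h5 := Nat.le_of_dvd (by omega) (hcop.symm.dvd_of_dvd_mul_left h4)
    omega

/-- The inequalities between slacks that determine the lasers in terms of the partition. -/
structure IsCompatible (π : SetPartition n) (F : ℕ → ℤ) : Prop where
  span_lt : ∀ i j, IsSpan π i j → F i < F (j + 1)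
  consecutive_lt : ∀ i j, IsConsecutive π i j → F (j + 1) < F (i + 1)

namespace IsCompatible

variable {F : ℕ → ℤ}

theorem antitone (hF : IsCompatible π F) {x y : Fin n} (hxy : π.part x = π.part y) (hle : x ≤ y) :
    F (y + 1) ≤ F (x + 1) := by
  induction hd : y.val - x.val using Nat.strong_induction_on generalizing y with
  | _ d ih =>
    rcases hle.eq_or_lt with rfl | hlt
    · exact le_rfl
    · obtain ⟨z, z', h1, h2, h3, h4, h5, h6⟩ := exists_straddling π hxy (Fin.lt_def.mp hlt) le_rfl
      obtain rfl : z' = y := le_antisymm h6 (Fin.le_def.mpr h5)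
      have h7 := Fin.le_def.mp h3
      exact (hF.consecutive_lt _ _ h1).le.trans (ih (z.val - x.val) (by omega) h2.symm h3 rfl)

/-- The value after `x` is at least the one after the maximum of its block, which exceeds the one at
its minimum `i ≥ p`; then repeat with the label before `i`. -/
theorem lt_of_closed (hF : IsCompatible π F) {p : ℕ} {x : Fin n} (hpx : p ≤ x.val)
    (hcl : ∀ y z : Fin n, p ≤ y.val → y ≤ x → π.part z = π.part y → p ≤ z.val) :
    F p < F (x + 1) := by
  induction hd : x.val using Nat.strong_induction_on generalizing x with
  | _ d ih =>
    subst hd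
    obtain ⟨i, j, h, he⟩ := exists_isSpan π x
    have h1 := h.le x he.symm
    have h2 := hcl x i hpx le_rfl he
    have h3 := (hF.span_lt i j h).trans_le (hF.antitone (he.symm.trans h.part_eq) h1.2)
    rcases h2.eq_or_lt with h4 | h4
    · rw [h4]; exact h3
    · have h5 := Fin.le_def.mp h1.1
      have h6 := ih (i.val - 1) (by omega) (x := ⟨i.val - 1, by omega⟩) (by simp only; omega)
        (fun y z hy hyx => hcl y z hy (Fin.le_def.mpr (by
          have := Fin.le_def.mp hyx; simp only at this; omega))) rfl
      simp only [Nat.sub_add_cancel (by omega : 1 ≤ i.val)] at h6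
      exact h6.trans h3

theorem pos (hF : IsCompatible π F) (x : Fin n) : F 0 < F (x + 1) :=
  hF.lt_of_closed (Nat.zero_le _) fun _ _ _ _ _ => Nat.zero_le _

theorem lt_of_mem_span (hF : IsCompatible π F) (hπ : IsNoncrossing π) {i j x : Fin n}
    (h : IsSpan π i j) (hx : x ∈ Finset.Icc i j) : F i < F (x + 1) := by
  refine hF.lt_of_closed (Fin.le_def.mp (Finset.mem_Icc.mp hx).1) fun y z hy hyx hzy => ?_
  have := h.mem_Icc_of_part_eq hπ hzy.symm
    (Finset.mem_Icc.mpr ⟨Fin.le_def.mpr hy, hyx.trans (Finset.mem_Icc.mp hx).2⟩)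
  exact Fin.le_def.mp (Finset.mem_Icc.mp this).1

theorem lt_of_mem_gap (hF : IsCompatible π F) (hπ : IsNoncrossing π) {i j x : Fin n}
    (h : IsConsecutive π i j) (hx : x ∈ Finset.Ioo i j) : F (i + 1) < F (x + 1) := by
  refine hF.lt_of_closed (Fin.lt_def.mp (Finset.mem_Ioo.mp hx).1) fun y z hy hyx hzy => ?_
  have := h.mem_Ioo_of_part_eq hπ hzy.symm
    (Finset.mem_Ioo.mpr ⟨Fin.lt_def.mpr hy, hyx.trans_lt (Finset.mem_Ioo.mp hx).2⟩)
  exact Fin.lt_def.mp (Finset.mem_Ioo.mp this).1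

/-- A pocket opening after `i` and no later than `j` must close before it contains `j`. -/
theorem lt_of_straddling (hF : IsCompatible π F) (hπ : IsNoncrossing π) {i j : Fin n} {p : ℕ}
    (h : IsConsecutive π i j) (hip : i.val < p) (hpj : p ≤ j.val) : F (j + 1) < F p := by
  rcases Nat.succ_le_of_lt hip |>.eq_or_lt with rfl | hlt
  · exact hF.consecutive_lt i j h
  · have h1 := hF.lt_of_mem_gap hπ h (x := ⟨p - 1, by omega⟩)
      (Finset.mem_Ioo.mpr ⟨Fin.lt_def.mpr (by simp only; omega), Fin.lt_def.mpr (by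
        simp only; omega)⟩)
    simp only [Nat.sub_add_cancel (by omega : 1 ≤ p)] at h1
    exact (hF.consecutive_lt i j h).trans h1

/-- A laser does not separate the elements of a block. -/
theorem mem_pocket_iff (hF : IsCompatible π F) (hπ : IsNoncrossing π) {p m : ℕ}
    (hlt : F (m + 1) < F p) (hle : ∀ t, p ≤ t → t ≤ m → F p ≤ F t) {i j : Fin n}
    (hij : π.part i = π.part j) (hi_le : i ≤ j) :
    (p ≤ i.val ∧ i.val < m) ↔ (p ≤ j.val ∧ j.val < m) := by
  have hl := Fin.le_def.mp hi_le
  constructor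
  · rintro ⟨h1, h2⟩
    refine ⟨h1.trans hl, ?_⟩
    by_contra h3
    obtain ⟨z, z', g1, g2, g3, g4, g5, g6⟩ := exists_straddling π hij h2 (not_lt.mp h3)
    have g3' := Fin.le_def.mp g3
    have g6' := Fin.le_def.mp g6
    -- If the crossing pair ends exactly at `m`, compare `F (m + 1)` with `F` at the minimum of the
    -- block: either it is too large, or the minimum lies left of `p` and another pair crosses `p`.
    -- If it ends later, `m` lies inside a gap, where `F` has not yet dropped.
    rcases g5.eq_or_lt with rfl | hm
    · obtain ⟨i₀, j₀, h, he⟩ := exists_isSpan π i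
      have hz' := (g1.part_eq.symm.trans g2).trans he.symm
      have e1 := h.le z' hz'
      have e2 := Fin.le_def.mp (h.le i he.symm).1
      rcases le_or_gt p i₀.val with h4 | h4
      · have e3 := hF.antitone (hz'.trans h.part_eq) e1.2
        have e4 := hF.span_lt _ _ h
        have e5 := hle i₀ h4 (by omega)
        omega
      · obtain ⟨u, u', f1, -, -, f4, f5, f6⟩ := exists_straddling π he h4 h1
        have e3 := hF.lt_of_straddling hπ f1 f4 f5
        have e4 := Fin.le_def.mp f6
        have e5 := hle (u' + 1) (by omega) (by omega)
        omega
    · have e1 := hF.lt_of_mem_gap hπ g1 (x := ⟨m, by omega⟩)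
        (Finset.mem_Ioo.mpr ⟨Fin.lt_def.mpr g4, Fin.lt_def.mpr hm⟩)
      have e2 := hle (z + 1) (by omega) (by omega)
      simp only at e1
      omega
  · rintro ⟨h1, h2⟩
    refine ⟨?_, by omega⟩
    by_contra h3
    obtain ⟨z, z', g1, g2, g3, g4, g5, g6⟩ := exists_straddling π hij (not_le.mp h3) h1
    have e1 := hF.lt_of_straddling hπ g1 g4 g5
    have g6' := Fin.le_def.mp g6
    have e2 := hle (z' + 1) (by omega) (by omega)
    omega

end IsCompatible

/-- The lasers of a path with compatible slack cut out the blocks. -/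
theorem DyckPath.part_eq_iff_of_isCompatible (D : DyckPath a b) (ha : 0 < a)
    (hcop : Nat.Coprime a b) {π : SetPartition (b - 1)} (hπ : IsNoncrossing π) {F : ℕ → ℤ}
    (hF : IsCompatible π F) (hD : ∀ x ≤ b, D.slack x = F x)
    (hspan : ∀ i j, IsSpan π i j → D.height i < D.height (i + 1)) (i j : Fin (b - 1)) :
    D.partition.part i = D.partition.part j ↔ π.part i = π.part j := by
  rw [D.partition_part_eq_iff]
  constructor
  -- Of two distinct blocks, take the one with the larger minimum `j₀`. The laser from `j₀` encloses
  -- its whole span, and cannot enclose an element of the other block, since a consecutive pair of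
  -- that block would then straddle `j₀`.
  · have key : ∀ i j : Fin (b - 1), (∀ q ∈ D.lasers,
        (q.1 ≤ i.val ∧ i.val < q.2 ↔ q.1 ≤ j.val ∧ j.val < q.2)) →
        ∀ i₀ i₁ j₀ j₁, IsSpan π i₀ i₁ → π.part i₀ = π.part i → IsSpan π j₀ j₁ →
          π.part j₀ = π.part j → ¬ i₀ < j₀ := by
      intro i j hsep i₀ i₁ j₀ j₁ hi hi' hj hj' hlt
      rw [Fin.lt_def] at hlt
      have hpos : D.slack b < D.slack j₀ := by
        rw [D.slack_last (by omega)]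
        exact D.slack_pos hcop (by omega) (by omega)
      obtain ⟨m, h1, h2, h3, h4⟩ := D.exists_first_slack_lt (p := j₀) (by omega) hpos
      have hq : (j₀.val, m) ∈ D.lasers := (D.mem_lasers_iff ha hcop _).mpr
        ⟨by simp only; omega, hspan _ _ hj, h1, h2, h3, fun t ht ht' => ht.eq_or_lt.elim
          (fun e => by rw [← e]) fun e => h4 t e ht'⟩
      have hjm := hj.le j hj'.symm
      have e1 := Fin.le_def.mp hjm.1
      have e2 := Fin.le_def.mp hjm.2
      have hm : j₁.val < m := by
        by_contra hm
        have e3 := hF.lt_of_mem_span hπ hj (x := ⟨m, by omega⟩)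
          (Finset.mem_Icc.mpr ⟨Fin.le_def.mpr h1, Fin.le_def.mpr (not_lt.mp hm)⟩)
        simp only at e3
        rw [hD _ (by omega), hD _ (by omega)] at h3
        omega
      have hs := hsep _ hq
      simp only at hs
      have hi2 : j₀.val ≤ i.val ∧ i.val < m := hs.mpr ⟨e1, by omega⟩
      obtain ⟨z, z', g1, g2, g3, g4, g5, g6⟩ := exists_straddling π hi' hlt hi2.1
      have e3 := hF.lt_of_straddling hπ g1 g4 g5
      have g6' := Fin.le_def.mp g6
      have e4 := h4 (z' + 1) (by omega) (by omega)
      rw [hD _ (by omega), hD _ (by omega)] at e4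
      omega
    intro hsep
    obtain ⟨i₀, i₁, hi, hi'⟩ := exists_isSpan π i
    obtain ⟨j₀, j₁, hj, hj'⟩ := exists_isSpan π j
    have h1 := key i j hsep _ _ _ _ hi hi' hj hj'
    have h2 := key j i (fun q hq => (hsep q hq).symm) _ _ _ _ hj hj' hi hi'
    rw [← hi', ← hj', le_antisymm (not_lt.mp h2) (not_lt.mp h1)]
  · rintro hij ⟨p, m⟩ hpm
    obtain ⟨-, -, g3, g4, g5, g6⟩ := (D.mem_lasers_iff ha hcop _).mp hpm
    simp only at g3 g4 g5 g6 ⊢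
    have hlt : F (m + 1) < F p := by rwa [hD _ (by omega), hD _ (by omega)] at g5
    have hle : ∀ t, p ≤ t → t ≤ m → F p ≤ F t := fun t h1 h2 => by
      have := g6 t h1 h2
      rwa [hD _ (by omega), hD _ (by omega)] at this
    rcases le_total i j with h | h
    · exact hF.mem_pocket_iff hπ hlt hle hij h
    · exact (hF.mem_pocket_iff hπ hlt hle hij.symm h).symm

theorem setPartition_ext {π ρ : SetPartition n}
    (h : ∀ i j, π.part i = π.part j ↔ ρ.part i = ρ.part j) : π = ρ := by
  have hpart : ∀ i, π.part i = ρ.part i := fun i => by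
    ext j
    rw [mem_part_iff, mem_part_iff, h]
  ext B
  constructor
  · intro hB
    obtain ⟨i, rfl⟩ := exists_part_eq hB
    rw [hpart]
    exact part_mem_parts ρ i
  · intro hB
    obtain ⟨i, rfl⟩ := exists_part_eq hB
    rw [← hpart]
    exact part_mem_parts π i

theorem mem_NC_of_isWeighting (ha : 0 < a) (hcop : Nat.Coprime a b) (hb : 0 < b)
    {π : SetPartition (b - 1)} (hπ : IsNoncrossing π) {w : Fin (b - 1) → ℤ}
    (hw : IsWeighting a b π w) (hg : FillsGaps a b π w) : π ∈ NC a b := by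
  obtain ⟨v, hv, hgv, hv0⟩ := hw.exists_isNormalized hπ hg
  have hF : IsCompatible π (weightSlack a b v) :=
    ⟨fun i j h => hv.weightSlack_lt hcop (by omega) h,
      fun i j h => hgv.weightSlack_lt hv0 hcop (by omega) h⟩
  have hmono : Monotone (partialSum v) := fun x y hxy => by
    refine Finset.sum_le_sum_of_subset_of_nonneg (fun z hz => ?_) fun z _ _ => hv0.nonneg hv z
    have := (Finset.mem_filter.mp hz).2
    exact Finset.mem_filter.mpr ⟨Finset.mem_univ z, by omega⟩
  have hnn : ∀ x, 0 ≤ partialSum v x := fun x => by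
    rw [← partialSum_zero v]; exact hmono (Nat.zero_le x)
  have hcast : ∀ x, (((partialSum v x).toNat : ℕ) : ℤ) = partialSum v x := fun x =>
    Int.toNat_of_nonneg (hnn x)
  have hlast : partialSum v b = a := by rw [partialSum_of_le v (by omega), hv.total]
  have hzero : weightSlack a b v 0 = 0 := by simp [weightSlack, partialSum_zero]
  obtain ⟨D, hD⟩ := DyckPath.exists_height_eq (a := a) (b := b)
    (H := fun x => (partialSum v x).toNat) (fun x y h => Int.toNat_le_toNat (hmono h))
    -- The path stays above the line because compatibility makes the slack exceed its initial value
    -- zero after every label; `x = b` lies beyond the labels and is treated through the total.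
    (by simp [partialSum_zero]) (by simp [hlast]) (fun x hx => by
      have h1 : 0 ≤ weightSlack a b v x := by
        rcases x with _ | x
        · rw [hzero]
        rcases hx.eq_or_lt with h | h
        · rw [weightSlack, h, hlast]
          linarith
        · have := hF.pos ⟨x, by omega⟩
          rw [hzero] at this
          exact this.le
      unfold weightSlack at h1
      rw [← hcast] at h1
      have h2 : (a : ℤ) * x ≤ b * (((partialSum v x).toNat : ℕ) : ℤ) := by linarith
      exact_mod_cast h2)
  refine ⟨D, setPartition_ext (D.part_eq_iff_of_isCompatible ha hcop hπ hF (fun x hx => ?_) ?_)⟩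
  · rw [DyckPath.slack, hD x hx, hcast, weightSlack]
  · intro i j h
    rw [hD _ (by omega), hD _ (by omega)]
    have h1 := hv0.pos_of_isSpan hv h
    have h2 := partialSum_succ v i
    have h3 := hcast i
    have h4 := hcast (i + 1)
    omega

end Reconstruction

end RationalCatalan

theorem mainTheorem8 (a b : ℕ) (ha : 0 < a) (hab : a < b) (hcop : Nat.Coprime a b)
    (π : RationalCatalan.SetPartition (b - 1)) (hπ : RationalCatalan.IsNoncrossing π) :
    π ∈ RationalCatalan.NC a b ↔
      ∀ ρ ∈ RationalCatalan.rotOrbit π, RationalCatalan.HasValidRanking a b ρ := by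
  obtain ⟨m, rfl⟩ : ∃ m, b = m + 2 := ⟨b - 2, by omega⟩
  constructor
  · rintro ⟨D, rfl⟩ ρ hρ
    obtain ⟨w, hw, hg⟩ := D.exists_isWeighting_partition ha hab hcop
    exact RationalCatalan.hasValidRanking_of_mem_rotOrbit (m := m) rfl hπ hw hg hρ
  · intro h
    obtain ⟨w, hw⟩ := (RationalCatalan.hasValidRanking_iff (by omega) hπ).mp (h π ⟨0, rfl⟩)
    exact RationalCatalan.mem_NC_of_isWeighting ha hcop (by omega) hπ hw
      (RationalCatalan.fillsGaps_of_rotOrbit (m := m) rfl hπ h hw)
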